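/- Let $n\ge 3$. A KM-arc of type $\tau$ in $\mathrm{PG}(2,2^n)$ is a set of $2^n+\tau$ points that every line meets in $0$, $2$ or $\tau$ points; it is a translation KM-arc if there is a line $m$ such that the group of elations with axis $m$ stabilising the set acts transitively on its points off $m$. For an $\mathbb F_2$-subspace $U$ of an $\mathbb F_{2^n}$-vector space, let $L_U$ be the set of points $\langle u\rangle_{\mathbb F_{2^n}}$ with $u\in U\setminus\{0\}$; the weight of a point $P=\langle u\rangle_{\mathbb F_{2^n}}$ in $L_U$ is $\dim_{\mathbb F_2}(U\cap\langle u\rangle_{\mathbb F_{2^n}})$, and $L_U\subseteq\mathrm{PG}(1,2^n)$ is an $i$-club if one of its points has weight $i$ and all its other points have weight one. **Theorem.** Let $\mathcal A$ be a translation KM-arc of type $2^{n-2}$ in $\mathrm{PG}(2,2^n)$. Then there are integers $t\ge 2$, $\ell\ge 0$ with $n=t(\ell+1)$, elements $a,b,c\in\mathbb F_{2^n}^*$ with $\mathbb F_2(b)=\mathbb F_{2^t}$, and an $\mathbb F_{2^t}$-subspace $\overline S\subseteq\mathbb F_{2^n}$ of dimension $\ell$ with - $c\,\mathbb F_{2^t}\cap\overline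 S=\{0\}$, - $1\in\overline S\oplus c\langle 1,b,\ldots,b^{t-3}\rangle_{\mathbb F_2}$ (the second summand being $\{0\}$ if $t=2$), - $a\notin\overline S\oplus c\langle 1,b,\ldots,b^{t-2}\rangle_{\mathbb F_2}$, such that, for $$U=\Big\{\Big(\overline s+\sum_{i=0}^{t-3}c\,x_i b^i+\alpha+\beta a,\ \alpha+\beta b\Big)\colon \overline s\in\overline S,\ x_i,\alpha,\beta\in\mathbb F_2\Big\}\subseteq\mathbb F_{2^n}^2,$$ $\dim_{\mathbb F_2}U=n$, $L_U$ is an $(n-2)$-club of $\mathrm{PG}(1,2^n)$, and $\mathcal A$ is $\mathrm{PGL}(3,2^n)$-equivalent to $$\mathcal A(U,(0,0,1))=(L_{U'}\setminus r)\cup(r\setminus L_U),$$ where $r$ is the line $X_2=0$ of $\mathrm{PG}(2,2^n)$, $U$ is identified with $\{(x,y,0)\colon (x,y)\in U\}$, and $U'=U\oplus\langle(0,0,1)\rangle_{\mathbb F_2}$. -/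

import Mathlib

open scoped LinearAlgebra.Projectivization IntermediateField

namespace KMArcs

section Geometry

variable {K V : Type*} [Field K] [AddCommGroup V] [Module K V]

/-- The points of the projective space of `V` that lie on the projective subspace of `W`. -/
def points (W : Submodule K V) : Set (ℙ K V) := {P | P.submodule ≤ W}

/-- Two sets of points are projectively equivalent if an element of `PGL(V)`,
i.e. the projectivity induced by some invertible linear map, carries one onto the other. -/
def ProjEquiv (A B : Set (ℙ K V)) : Prop :=
  ∃ g : V ≃ₗ[K] V, (fun P : ℙ K V => g • P) '' A = B

/-- `W` is a line of the projective space of `V`. -/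
def IsLine (W : Submodule K V) : Prop := Module.finrank K W = 2

/-- The projectivity induced by `g` is an elation with axis `W` (the identity included):
it fixes every point of the axis, and every line through some point (a centre) of the axis. -/
def IsElation (W : Submodule K V) (g : V ≃ₗ[K] V) : Prop :=
  (∀ P ∈ points W, g • P = P) ∧
    ∃ C ∈ points W, ∀ M : Submodule K V, IsLine M → C ∈ points M →
      M.map (g : V →ₗ[K] V) = M

end Geometry

section Arcs

variable {K : Type*} [Field K]

/-- A KM-arc of type `t` in the plane `PG(2, K)`, `K` a finite field: a set of `|K| + t` points
that every line meets in `0`, `2` or `t` points. -/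
def IsKMArc (t : ℕ) (A : Set (ℙ K (Fin 3 → K))) : Prop :=
  A.ncard = Nat.card K + t ∧
    ∀ W : Submodule K (Fin 3 → K), IsLine W →
      (A ∩ points W).ncard = 0 ∨ (A ∩ points W).ncard = 2 ∨ (A ∩ points W).ncard = t

/-- A translation KM-arc of type `t`: for some line, the elations with that line as axis
that stabilise the arc act transitively on the points of the arc off the line. -/
def IsTranslationKMArc (t : ℕ) (A : Set (ℙ K (Fin 3 → K))) : Prop :=
  IsKMArc t A ∧
    ∃ W : Submodule K (Fin 3 → K), IsLine W ∧
      ∀ P ∈ A \ points W, ∀ Q ∈ A \ points W,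
        ∃ g : (Fin 3 → K) ≃ₗ[K] (Fin 3 → K),
          IsElation W g ∧ (fun R : ℙ K (Fin 3 → K) => g • R) '' A = A ∧ g • P = Q

end Arcs

section LinearSets

variable {F K V : Type*} [Field F] [Field K] [Algebra F K]
  [AddCommGroup V] [Module K V] [Module F V] [IsScalarTower F K V]

variable (K) in
/-- The `F`-linear set `L_U` defined by the `F`-subspace `U`. -/
def linearSet (U : Submodule F V) : Set (ℙ K V) :=
  {P | ∃ (u : V) (hu : u ≠ 0), u ∈ U ∧ P = Projectivization.mk K u hu}

/-- The weight of the point `P` in `L_U`. -/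
noncomputable def weight (U : Submodule F V) (P : ℙ K V) : ℕ :=
  Module.finrank F ↥(U ⊓ P.submodule.restrictScalars F)

/-- `L_U` is an `i`-club: one of its points has weight `i`, all the others have weight one.
(This is used on the projective line only.) -/
def IsClub (i : ℕ) (U : Submodule F (Fin 2 → K)) : Prop :=
  ∃ P ∈ linearSet K U, weight U P = i ∧ ∀ Q ∈ linearSet K U, Q ≠ P → weight U Q = 1

end LinearSets

section Construction

variable {F K : Type*} [Field F] [Field K] [Algebra F K]

variable (K) in
/-- The line `X₂ = 0` of `PG(2, K)`. -/
def lineX2 : Submodule K (Fin 3 → K) :=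
  LinearMap.ker (LinearMap.proj (R := K) (φ := fun _ : Fin 3 => K) 2)

variable (F K) in
/-- The identification `(x, y) ↦ (x, y, 0)` of the projective line with the line `X₂ = 0`. -/
def embedLine : (Fin 2 → K) →ₗ[F] (Fin 3 → K) where
  toFun w := ![w 0, w 1, 0]
  map_add' w z := by ext j; fin_cases j <;> simp
  map_smul' r w := by ext j; fin_cases j <;> simp

/-- The point set `A(U, v) = (L_{U'} \ ℓ) ∪ (ℓ \ L_U)`, where `ℓ : X₂ = 0` and
`U' = U + ⟨v⟩_F`. -/
def arcOf (U : Submodule F (Fin 3 → K)) (v : Fin 3 → K) : Set (ℙ K (Fin 3 → K)) :=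
  (linearSet K (U ⊔ Submodule.span F {v}) \ points (lineX2 K)) ∪
    (points (lineX2 K) \ linearSet K U)

/-- The `F`-subspace `S̄ + c⟨1, b, …, b^{m-1}⟩_F` of `K`, for an `F(b)`-subspace `S̄`. -/
noncomputable def sumSpan (b c : K) (S : Submodule F⟮b⟯ K) (m : ℕ) : Submodule F K :=
  S.restrictScalars F ⊔ Submodule.span F {y | ∃ i < m, y = c * b ^ i}

/-- The `F`-subspace
`{(s̄ + ∑_{i=0}^{t-3} c xᵢ bⁱ + α + β a, α + β b) : s̄ ∈ S̄, xᵢ, α, β ∈ F}` of `K²`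
(the sum is empty for `t = 2`). -/
def clubSpace (t : ℕ) (a b c : K) (S : Submodule F⟮b⟯ K) : Submodule F (Fin 2 → K) where
  carrier := {w | ∃ s ∈ S, ∃ (x : Fin (t - 2) → F) (α β : F),
    w = ![s + ∑ i, c * algebraMap F K (x i) * b ^ (i : ℕ) + algebraMap F K α
            + algebraMap F K β * a,
          algebraMap F K α + algebraMap F K β * b]}
  zero_mem' := ⟨0, S.zero_mem, 0, 0, 0, by ext j; fin_cases j <;> simp⟩
  add_mem' := by
    rintro _ _ ⟨s, hs, x, α, β, rfl⟩ ⟨s', hs', x', α', β', rfl⟩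
    refine ⟨s + s', S.add_mem hs hs', x + x', α + α', β + β', ?_⟩
    ext j
    fin_cases j
    · simp [mul_add, add_mul, Finset.sum_add_distrib]
      ring
    · simp
      ring
  smul_mem' := by
    rintro r _ ⟨s, hs, x, α, β, rfl⟩
    refine ⟨r • s, (S.restrictScalars F).smul_mem r hs, r • x, r * α, r * β, ?_⟩
    ext j
    fin_cases j
    · simp [Algebra.smul_def, mul_add, Finset.mul_sum]
      have h : ∀ i : Fin (t - 2), algebraMap F K r * (c * algebraMap F K (x i) * b ^ (i : ℕ)) =
          c * (algebraMap F K r * algebraMap F K (x i)) * b ^ (i : ℕ) := fun i => by ring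
      simp only [h]
      ring
    · simp [Algebra.smul_def]
      ring

/-- The conditions on the parameters of the `(n-2)`-clubs: `n = t(ℓ+1)`, `a, b, c ≠ 0`,
`F(b)` has degree `t ≥ 2` over `F`, `S̄` is an `F(b)`-subspace of dimension `ℓ` meeting `c F(b)`
trivially, `1 ∈ S̄ ⊕ c⟨1, …, b^{t-3}⟩_F` and `a ∉ S̄ ⊕ c⟨1, …, b^{t-2}⟩_F`. -/
structure IsClubData (n t l : ℕ) (a b c : K) (S : Submodule F⟮b⟯ K) : Prop where
  two_le : 2 ≤ t
  degree : n = t * (l + 1)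
  a_ne : a ≠ 0
  b_ne : b ≠ 0
  c_ne : c ≠ 0
  finrank_adjoin : Module.finrank F F⟮b⟯ = t
  finrank_S : Module.finrank F⟮b⟯ S = l
  disjoint : Submodule.span F⟮b⟯ {c} ⊓ S = ⊥
  one_mem : (1 : K) ∈ sumSpan b c S (t - 2)
  a_notMem : a ∉ sumSpan b c S (t - 1)

end Construction

end KMArcs

/-! Let F be the field with two elements and K the field of order 2^n. An elation acts on the
vectors of its axis W by a single scalar, and off W it is translation by a vector of W times that
same scalar. Transitivity therefore makes the set of w in W with v + w over A, for a fixed v over a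
point of A off W, closed under addition (`add_mem_cone_of_transitive`). With W as the line X₂ = 0
and v as (0, 0, 1), the affine part of A is an F-subspace U of K².

A line joining a point P of the axis to the origin meets A in 2^(weight of P) affine points, plus P
itself if P is in A. The admissible sizes 0, 2, 2^(n-2) force P to be in A exactly when P is off
L_U, and weights in L_U to be 1 or n-2. Counting A gives |U| = 2^n (`exists_eq_arcOf_of_add_mem`),
and counting the nonzero vectors of U leaves room for just one heavy point (`isClub_of_weights`).

For the normal form, move the heavy point to ⟨(1, 0)⟩. Then U is spanned by S × {0}, with S of
codimension two in K, and two vectors that can be normalised to (0, 1) and (a, b), with 1 in S. If a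
were in S + bS, some u outside the heavy point would have both u and bu in U, so a weight of at
least 2; hence a is not in S + bS (`exists_map_eq_clubSpace_of_weight`). A functional f killing S +
bS but not a determines S as {x : f(x) = f(bx) = 0}. Decomposing K over F(b) as cF(b) plus the
largest F(b)-subspace in ker f, with c dual to the top power of b, gives the shape of S
(`exists_isClubData`). -/

namespace KMArcs

/-! ### Subspaces of codimension two cut out by one functional and multiplication by b. -/

section ClubData

variable {F K : Type*} [Field F] [Field K] [Algebra F K]

/-- If `f` vanishes on `S` and on `b S`, where `S` has codimension two and `b ∉ F`,
then `S` consists of all `x` with `f x = f (b x) = 0`. -/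
theorem mem_of_dual_eq_zero [FiniteDimensional F K] {S : Submodule F K} {b : K}
    (hS : Module.finrank F S + 2 = Module.finrank F K) (hb : b ∉ (⊥ : IntermediateField F K))
    {f : K →ₗ[F] F} (hf : f ≠ 0) (h₀ : ∀ x ∈ S, f x = 0) (h₁ : ∀ x ∈ S, f (b * x) = 0)
    {x : K} (hx₀ : f x = 0) (hx₁ : f (b * x) = 0) : x ∈ S := by
  set g : K →ₗ[F] F := f ∘ₗ LinearMap.mulLeft F b with hg
  have hle : S ≤ f.ker ⊓ g.ker := fun y hy => ⟨h₀ y hy, h₁ y hy⟩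
  have hnot : ¬ f.ker ≤ g.ker := by
    intro h
    obtain ⟨k, hk⟩ : ∃ k : F, k • f = g := by
      have := mem_span_of_iInf_ker_le_ker (L := fun _ : Unit => f) (K := g) (by simpa using h)
      simpa [Submodule.mem_span_singleton] using this
    apply hf
    have hbk : b - algebraMap F K k ≠ 0 := fun h0 =>
      hb (IntermediateField.mem_bot.2 ⟨k, (sub_eq_zero.1 h0).symm⟩)
    ext y
    -- If g = k f, then f kills every multiple of b - k, which is a unit because b is not in F.
    have h2 := LinearMap.congr_fun hk ((b - algebraMap F K k)⁻¹ * y)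
    have h3 : b * ((b - algebraMap F K k)⁻¹ * y) - k • ((b - algebraMap F K k)⁻¹ * y) = y := by
      rw [Algebra.smul_def]
      field_simp
    rw [← h3, map_sub, map_smul]
    simp only [hg, LinearMap.smul_apply, LinearMap.comp_apply, LinearMap.mulLeft_apply] at h2
    rw [h2]; simp
  -- The two kernels meet in codimension at least two, which is the codimension of S.
  have hlt : f.ker ⊓ g.ker < f.ker := by
    refine lt_of_le_of_ne inf_le_left fun h => hnot (inf_eq_left.1 h)
  have h4 := Submodule.finrank_lt_finrank_of_lt hlt
  have h5 := Module.Dual.finrank_ker_add_one_of_ne_zero (f := f) hf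
  have h6 : S = f.ker ⊓ g.ker := Submodule.eq_of_le_of_finrank_le hle (by omega)
  rw [h6]
  exact ⟨hx₀, hx₁⟩

/-- If `f a ≠ 0`, every functional `z ↦ f (z x)` on `F(b)` has the form `z ↦ f (z μ a)`, and some
`μ` gives the functional dual to the top element of the basis `1, b, …, b^t` of `F(b)`. -/
theorem exists_dual_power_basis [FiniteDimensional F K] {b a : K} {f : K →ₗ[F] F}
    (ha : f a ≠ 0) {t : ℕ} (ht : Module.finrank F F⟮b⟯ = t + 1) :
    (∀ x : K, ∃ μ : F⟮b⟯, ∀ z : F⟮b⟯, f (z * x) = f (z * (μ * a))) ∧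
    ∃ μ : F⟮b⟯, μ ≠ 0 ∧ (∀ i < t, f (b ^ i * (μ * a)) = 0) ∧ f (b ^ t * (μ * a)) = 1 := by
  let D : K →ₗ[F] Module.Dual F F⟮b⟯ :=
    (LinearMap.compRight F f) ∘ₗ (LinearMap.mul F K).flip.compl₂ F⟮b⟯.val.toLinearMap
  have hD : ∀ x z, D x z = f (z * x) := fun x z => rfl
  let B : F⟮b⟯ →ₗ[F] Module.Dual F F⟮b⟯ :=
    D ∘ₗ (LinearMap.mulRight F a) ∘ₗ F⟮b⟯.val.toLinearMap
  have hB : ∀ μ z, B μ z = f (z * (μ * a)) := fun x z => rfl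
  have hinj : Function.Injective B := by
    rw [← LinearMap.ker_eq_bot, LinearMap.ker_eq_bot']
    intro μ hμ
    by_contra h0
    apply ha
    -- Testing the functional at the inverse of μ returns f a, which is nonzero.
    have := LinearMap.congr_fun hμ μ⁻¹
    rw [hB] at this
    have h0' : (μ : K) ≠ 0 := by simpa using h0
    simpa [h0'] using this
  have hsurj : Function.Surjective B :=
    (LinearMap.injective_iff_surjective_of_finrank_eq_finrank
      (Subspace.dual_finrank_eq (K := F) (V := F⟮b⟯)).symm).1 hinj
  refine ⟨fun x => ?_, ?_⟩
  · obtain ⟨μ, hμ⟩ := hsurj (D x)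
    exact ⟨μ, fun z => by rw [← hB, hμ, hD]⟩
  · let pb := IntermediateField.adjoin.powerBasis (K := F) (IsIntegral.of_finite F b)
    have hdim : pb.dim = t + 1 := by rw [← pb.finrank, ht]
    obtain ⟨μ, hμ⟩ := hsurj (pb.basis.coord ⟨t, by omega⟩)
    have key : ∀ i (hi : i < pb.dim), f (b ^ i * (μ * a)) =
        if i = t then 1 else 0 := by
      intro i hi
      have h1 := LinearMap.congr_fun hμ (pb.basis ⟨i, hi⟩)
      rw [hB] at h1
      simp only [Module.Basis.coord_apply, Module.Basis.repr_self] at h1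
      have h2 : ((pb.basis ⟨i, hi⟩ : F⟮b⟯) : K) = b ^ i := by
        simp [pb]
      rw [h2] at h1
      rw [h1, Finsupp.single_apply]
      simp
    refine ⟨μ, ?_, fun i hi => ?_, ?_⟩
    · rintro rfl
      have := key t (by omega)
      simp at this
    · rw [key i (by omega), if_neg hi.ne]
    · rw [key t (by omega), if_pos rfl]

theorem exists_eq_sum_pow [FiniteDimensional F K] (b : K) {t : ℕ}
    (ht : Module.finrank F F⟮b⟯ = t) (z : F⟮b⟯) :
    ∃ g : ℕ → F, (z : K) = ∑ i ∈ Finset.range t, algebraMap F K (g i) * b ^ i := by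
  let pb := IntermediateField.adjoin.powerBasis (K := F) (IsIntegral.of_finite F b)
  have hdim : pb.dim = t := by rw [← pb.finrank, ht]
  subst hdim
  -- Coefficients are indexed by ℕ, with default 0, so that top terms can later be split off the
  -- sum.
  refine ⟨fun i => if h : i < pb.dim then pb.basis.repr z ⟨i, h⟩ else 0, ?_⟩
  rw [Finset.sum_range]
  conv_lhs => rw [← pb.basis.sum_repr z]
  push_cast
  refine Finset.sum_congr rfl fun i _ => ?_
  rw [dif_pos i.2]
  simp [pb, Algebra.smul_def]

/-- A subspace `S ∋ 1` of codimension two with `a ∉ S + b S` has the form `S̄ ⊕ c⟨1, …, b^{t-3}⟩`. -/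
theorem exists_isClubData [FiniteDimensional F K] {S : Submodule F K} {a b : K}
    (hS : Module.finrank F S + 2 = Module.finrank F K) (h1 : (1 : K) ∈ S)
    (hb : b ∉ (⊥ : IntermediateField F K)) (ha : a ∉ S ⊔ S.map (LinearMap.mulLeft F b)) :
    ∃ (t l : ℕ) (c : K) (T : Submodule F⟮b⟯ K),
      IsClubData (Module.finrank F K) t l a b c T ∧ sumSpan b c T (t - 2) = S := by
  obtain ⟨f, hfa, hf⟩ := Submodule.exists_dual_map_eq_bot_of_notMem ha inferInstance
  have hker : ∀ x ∈ S ⊔ S.map (LinearMap.mulLeft F b), f x = 0 := fun x hx => by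
    have : f x ∈ (S ⊔ S.map (LinearMap.mulLeft F b)).map f := ⟨x, hx, rfl⟩
    rwa [hf, Submodule.mem_bot] at this
  have h₀ : ∀ x ∈ S, f x = 0 := fun x hx => hker x (Submodule.mem_sup_left hx)
  have h₁ : ∀ x ∈ S, f (b * x) = 0 := fun x hx =>
    hker _ (Submodule.mem_sup_right ⟨x, hx, rfl⟩)
  have hf0 : f ≠ 0 := by rintro rfl; simp at hfa
  obtain ⟨m, hm⟩ : ∃ m, Module.finrank F F⟮b⟯ = m + 2 := by
    have h2 : Module.finrank F F⟮b⟯ ≠ 1 := by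
      rwa [Ne, IntermediateField.finrank_adjoin_simple_eq_one_iff]
    have h3 : 0 < Module.finrank F F⟮b⟯ := Module.finrank_pos
    exact ⟨Module.finrank F F⟮b⟯ - 2, by omega⟩
  obtain ⟨hD, μ, hμ0, hμ, hμ'⟩ := exists_dual_power_basis (b := b) hfa (t := m + 1) hm
  -- Here t = m + 2, and z ↦ f (z c) is the coordinate of b^(m+1) in the power basis of F(b).
  set c : K := μ * a with hc
  have ha0 : a ≠ 0 := by rintro rfl; simp at hfa
  have hμ0' : (μ : K) ≠ 0 := by simpa using hμ0
  have hc0 : c ≠ 0 := mul_ne_zero hμ0' ha0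
  -- The largest F(b)-subspace inside ker f.
  let T : Submodule F⟮b⟯ K :=
    { carrier := {x | ∀ z : F⟮b⟯, f (z * x) = 0}
      zero_mem' := fun z => by simp
      add_mem' := fun {x y} hx hy z => by rw [mul_add, map_add, hx z, hy z, add_zero]
      smul_mem' := fun w x hx z => by
        have := hx (z * w)
        simpa [Algebra.smul_def, mul_assoc] using this }
  have hT : ∀ x, x ∈ T ↔ ∀ z : F⟮b⟯, f (z * x) = 0 := fun x => Iff.rfl
  have hbL : b ∈ F⟮b⟯ := IntermediateField.mem_adjoin_simple_self F b
  have hdisj : Submodule.span F⟮b⟯ {c} ⊓ T = ⊥ := by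
    rw [eq_bot_iff]
    rintro x ⟨hx, hxT⟩
    obtain ⟨w, rfl⟩ := Submodule.mem_span_singleton.1 hx
    by_contra h0
    have hw : (w : K) ≠ 0 := by
      intro h
      apply h0
      have : w = 0 := by simpa using h
      simp [this]
    -- This multiplier cancels w and leaves f (b^(m+1) c) = 1.
    have := (hT _).1 hxT (⟨b, hbL⟩ ^ (m + 1) * w⁻¹)
    simp only [Algebra.smul_def, IntermediateField.algebraMap_apply] at this
    have h2 : (((⟨b, hbL⟩ ^ (m + 1) * w⁻¹ : F⟮b⟯)) : K) * (w * c) = b ^ (m + 1) * c := by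
      push_cast
      field_simp
    rw [h2, hμ'] at this
    exact one_ne_zero this
  have hdecomp : ∀ x : K, ∃ w : F⟮b⟯, x - w * c ∈ T := by
    intro x
    obtain ⟨ν, hν⟩ := hD x
    refine ⟨ν * μ⁻¹, fun z => ?_⟩
    have : ((ν * μ⁻¹ : F⟮b⟯) : K) * c = ν * a := by
      push_cast; rw [hc]; field_simp
    rw [this, mul_sub, map_sub, hν, sub_self]
  have hcompl : IsCompl (Submodule.span F⟮b⟯ {c}) T := by
    refine ⟨disjoint_iff.2 hdisj, codisjoint_iff.2 (eq_top_iff.2 fun x _ => ?_)⟩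
    obtain ⟨w, hw⟩ := hdecomp x
    rw [Submodule.mem_sup]
    exact ⟨w * c, Submodule.mem_span_singleton.2 ⟨w, by simp [Algebra.smul_def]⟩, _, hw, by ring⟩
  have hsum : sumSpan b c T m = S := by
    apply le_antisymm
    · refine sup_le (fun x hx => ?_) (Submodule.span_le.2 ?_)
      · refine mem_of_dual_eq_zero hS hb hf0 h₀ h₁ ?_ ?_
        · simpa using hx 1
        · exact hx ⟨b, hbL⟩
      · rintro _ ⟨i, hi, rfl⟩
        refine mem_of_dual_eq_zero hS hb hf0 h₀ h₁ ?_ ?_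
        · rw [mul_comm]; exact hμ i (by omega)
        · have := hμ (i + 1) (by omega)
          rwa [show b * (c * b ^ i) = b ^ (i + 1) * c by ring]
    · intro x hx
      obtain ⟨w, hw⟩ := hdecomp x
      obtain ⟨g, hg⟩ := exists_eq_sum_pow b hm w
      have e₀ : f (w * c) = 0 := by
        have := (hT _).1 hw 1
        simpa [h₀ x hx] using this
      have e₁ : f (b * (w * c)) = 0 := by
        have := (hT _).1 hw ⟨b, hbL⟩
        simpa [mul_sub, h₁ x hx] using this
      have eg : ∀ i (y : K), f (algebraMap F K (g i) * y) = g i * f y := fun i y => by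
        rw [← Algebra.smul_def, map_smul, smul_eq_mul]
      -- f (w c) reads off the top coefficient of w. Once it is zero, f (b w c) reads off the next
      -- one, since multiplying by b shifts exponents by one.
      have hg1 : g (m + 1) = 0 := by
        rw [hg, Finset.sum_mul, map_sum, Finset.sum_range_succ] at e₀
        rw [Finset.sum_eq_zero] at e₀
        · rwa [mul_assoc, eg, hμ', mul_one, zero_add] at e₀
        · intro i hi
          rw [mul_assoc, eg, hμ i (by simpa using hi), mul_zero]
      have hg0 : g m = 0 := by
        rw [hg, Finset.sum_range_succ, hg1, map_zero, zero_mul, add_zero, mul_left_comm,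
          Finset.sum_mul, map_sum, Finset.sum_range_succ, Finset.sum_eq_zero, zero_add,
          mul_assoc, eg, show b ^ m * (b * c) = b ^ (m + 1) * c by ring, hμ', mul_one] at e₁
        · exact e₁
        · intro i hi
          rw [Finset.mem_range] at hi
          rw [mul_assoc, eg, show b ^ i * (b * c) = b ^ (i + 1) * c by ring,
            hμ (i + 1) (by omega), mul_zero]
      have hwm : (w : K) = ∑ i ∈ Finset.range m, algebraMap F K (g i) * b ^ i := by
        rw [hg, Finset.sum_range_succ, Finset.sum_range_succ, hg0, hg1]
        simp
      have hx' : x = (x - w * c) + w * c := by ring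
      rw [hx', sumSpan]
      refine Submodule.add_mem_sup hw ?_
      rw [hwm, Finset.sum_mul]
      refine Submodule.sum_mem _ fun i hi => ?_
      rw [mul_assoc, ← Algebra.smul_def]
      exact Submodule.smul_mem _ _ (Submodule.subset_span ⟨i, by simpa using hi, by ring⟩)
  refine ⟨m + 2, Module.finrank F⟮b⟯ T, c, T, ?_, hsum⟩
  refine ⟨by omega, ?_, ha0, ?_, hc0, hm, rfl, hdisj, by simpa [hsum] using h1, ?_⟩
  -- K has dimension 1 + l over F(b), and the tower formula gives n = t (l + 1).
  · have h2 := Submodule.finrank_add_eq_of_isCompl hcompl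
    rw [finrank_span_singleton hc0] at h2
    rw [← Module.finrank_mul_finrank F F⟮b⟯ K, hm, ← h2, add_comm 1]
  · rintro rfl
    exact hb (zero_mem _)
  · intro h
    apply hfa
    have : sumSpan b c T (m + 2 - 1) ≤ f.ker := by
      refine sup_le (fun x hx => ?_) (Submodule.span_le.2 ?_)
      · simpa using (hT x).1 hx 1
      · rintro _ ⟨i, hi, rfl⟩
        rw [mul_comm]
        exact hμ i (by omega)
    exact this h

/-- The xᵢ are coordinates on the span of the c bⁱ, so the club space depends on T and c only
through `sumSpan`. -/
theorem mem_clubSpace {t : ℕ} {a b c : K} {T : Submodule F⟮b⟯ K} {w : Fin 2 → K} :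
    w ∈ clubSpace t a b c T ↔ ∃ s ∈ sumSpan b c T (t - 2), ∃ α β : F,
      w = ![s + algebraMap F K α + algebraMap F K β * a, algebraMap F K α + algebraMap F K β * b] := by
  have hset : {y | ∃ i < t - 2, y = c * b ^ i} = Set.range fun i : Fin (t - 2) => c * b ^ (i : ℕ) := by
    ext y
    constructor
    · rintro ⟨i, hi, rfl⟩
      exact ⟨⟨i, hi⟩, rfl⟩
    · rintro ⟨i, rfl⟩
      exact ⟨i, i.2, rfl⟩
  have hx : ∀ x : Fin (t - 2) → F, ∑ i, c * algebraMap F K (x i) * b ^ (i : ℕ) =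
      ∑ i, x i • (c * b ^ (i : ℕ)) := fun x =>
    Finset.sum_congr rfl fun i _ => by rw [Algebra.smul_def]; ring
  constructor
  · rintro ⟨s, hs, x, α, β, rfl⟩
    refine ⟨s + ∑ i, c * algebraMap F K (x i) * b ^ (i : ℕ), ?_, α, β, rfl⟩
    refine Submodule.add_mem_sup hs ?_
    rw [hset, Submodule.mem_span_range_iff_exists_fun]
    exact ⟨x, (hx x).symm⟩
  · rintro ⟨s, hs, α, β, rfl⟩
    obtain ⟨s, hs', y, hy, rfl⟩ := Submodule.mem_sup.1 hs
    rw [hset, Submodule.mem_span_range_iff_exists_fun] at hy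
    obtain ⟨x, rfl⟩ := hy
    exact ⟨s, hs', x, α, β, by rw [hx]⟩

end ClubData

/-! ### Membership in a linear set without a chosen representative. -/

section LinearSetMembership

variable {F K V : Type*} [Field F] [Field K] [AddCommGroup V] [Module K V] [Module F V]

theorem mem_linearSet_iff {U : Submodule F V} {P : ℙ K V} :
    P ∈ linearSet K U ↔ ∃ u ∈ U, u ≠ 0 ∧ u ∈ P.submodule := by
  constructor
  · rintro ⟨u, hu, huU, rfl⟩
    exact ⟨u, huU, hu, by rw [Projectivization.submodule_mk]; exact Submodule.mem_span_singleton_self u⟩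
  · rintro ⟨u, huU, hu, huP⟩
    refine ⟨u, hu, huU, ?_⟩
    induction P using Projectivization.ind with
    | h v hv =>
      rw [Projectivization.submodule_mk, Submodule.mem_span_singleton] at huP
      obtain ⟨k, rfl⟩ := huP
      rw [Eq.comm, Projectivization.mk_eq_mk_iff']
      exact ⟨k, rfl⟩

end LinearSetMembership

/-! ### Projectivities acting on linear sets, weights, clubs and arcs. -/

section Transport

variable {F K V : Type*} [Field F] [Field K] [Algebra F K]
  [AddCommGroup V] [Module K V] [Module F V] [IsScalarTower F K V]

theorem mk_mem_points {W : Submodule K V} {v : V} (hv : v ≠ 0) :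
    Projectivization.mk K v hv ∈ points W ↔ v ∈ W := by
  rw [points, Set.mem_ofPred_eq, Projectivization.submodule_mk, Submodule.span_singleton_le_iff_mem]

theorem smul_mem_points {W : Submodule K V} (g : V ≃ₗ[K] V) (P : ℙ K V) :
    g • P ∈ points W ↔ P ∈ points (W.comap (g : V →ₗ[K] V)) := by
  induction P using Projectivization.ind with
  | h v hv => rw [Projectivization.smul_mk, mk_mem_points, mk_mem_points]; rfl

theorem smul_mem_points_map {W : Submodule K V} (g : V ≃ₗ[K] V) (P : ℙ K V) :
    g • P ∈ points (W.map (g : V →ₗ[K] V)) ↔ P ∈ points W := by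
  rw [smul_mem_points, Submodule.comap_map_eq_of_injective g.injective]

theorem submodule_smul (g : V ≃ₗ[K] V) (P : ℙ K V) :
    (g • P).submodule = P.submodule.map (g : V →ₗ[K] V) := by
  induction P using Projectivization.ind with
  | h v hv =>
    rw [Projectivization.smul_mk, Projectivization.submodule_mk, Projectivization.submodule_mk,
      Submodule.map_span, Set.image_singleton]
    rfl

theorem smul_mem_linearSet_map (g : V ≃ₗ[K] V) {U : Submodule F V} {P : ℙ K V} :
    g • P ∈ linearSet K (U.map (g.restrictScalars F : V →ₗ[F] V)) ↔ P ∈ linearSet K U := by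
  simp only [mem_linearSet_iff, submodule_smul, Submodule.mem_map]
  constructor
  · rintro ⟨_, ⟨u, hu, rfl⟩, h0, u', hu', h⟩
    obtain rfl : u' = u := g.injective h
    exact ⟨u', hu, fun h => h0 (by simp [h]), hu'⟩
  · rintro ⟨u, hu, h0, hu'⟩
    exact ⟨g u, ⟨u, hu, rfl⟩, by simpa using h0, u, hu', rfl⟩

theorem weight_map_smul (g : V ≃ₗ[K] V) (U : Submodule F V) (P : ℙ K V) :
    weight (U.map (g.restrictScalars F : V →ₗ[F] V)) (g • P) = weight U P := by
  have : U.map (g.restrictScalars F : V →ₗ[F] V) ⊓ (g • P).submodule.restrictScalars F =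
      (U ⊓ P.submodule.restrictScalars F).map (g.restrictScalars F : V →ₗ[F] V) := by
    rw [Submodule.map_inf _ (g.restrictScalars F).injective, submodule_smul]
    rfl
  rw [weight, this, LinearEquiv.finrank_map_eq]
  rfl

theorem IsClub.map {i : ℕ} {U : Submodule F (Fin 2 → K)} (hU : IsClub i U)
    (g : (Fin 2 → K) ≃ₗ[K] (Fin 2 → K)) :
    IsClub i (U.map (g.restrictScalars F : (Fin 2 → K) →ₗ[F] (Fin 2 → K))) := by
  obtain ⟨P, hP, hw, h⟩ := hU
  refine ⟨g • P, (smul_mem_linearSet_map g).2 hP, by rw [weight_map_smul, hw], fun Q hQ hne => ?_⟩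
  obtain ⟨R, rfl⟩ : ∃ R, g • R = Q := ⟨g⁻¹ • Q, by simp⟩
  rw [weight_map_smul]
  exact h R ((smul_mem_linearSet_map g).1 hQ) fun h => hne (by rw [h])

/-- Preserving the last coordinate makes g stabilise the line X₂ = 0, so both halves of the arc are
carried over. -/
theorem image_arcOf (g : (Fin 3 → K) ≃ₗ[K] (Fin 3 → K))
    (hg : ∀ x, g x 2 = x 2) (U : Submodule F (Fin 3 → K)) (v : Fin 3 → K) :
    (fun P : ℙ K (Fin 3 → K) => g • P) '' arcOf U v =
      arcOf (U.map (g.restrictScalars F : (Fin 3 → K) →ₗ[F] (Fin 3 → K))) (g v) := by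
  have hline : (lineX2 K).comap (g : (Fin 3 → K) →ₗ[K] (Fin 3 → K)) = lineX2 K := by
    ext x
    simp [lineX2, hg]
  have hspan : U.map (g.restrictScalars F : (Fin 3 → K) →ₗ[F] (Fin 3 → K)) ⊔
      Submodule.span F {g v} = (U ⊔ Submodule.span F {v}).map
        (g.restrictScalars F : (Fin 3 → K) →ₗ[F] (Fin 3 → K)) := by
    rw [Submodule.map_sup, Submodule.map_span, Set.image_singleton]
    rfl
  ext Q
  obtain ⟨R, rfl⟩ : ∃ R, g • R = Q := ⟨g⁻¹ • Q, by simp⟩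
  rw [(MulAction.injective g).mem_set_image, arcOf, arcOf, hspan]
  simp only [Set.mem_union, Set.mem_sdiff, smul_mem_linearSet_map, smul_mem_points, hline]

theorem ProjEquiv.trans {A B C : Set (ℙ K V)} (h : ProjEquiv A B) (h' : ProjEquiv B C) :
    ProjEquiv A C := by
  obtain ⟨g, rfl⟩ := h
  obtain ⟨g', rfl⟩ := h'
  exact ⟨g' * g, by rw [Set.image_image]; simp only [mul_smul]⟩

/-- The extension of an automorphism of the line `X₂ = 0` to the plane fixing `(0, 0, 1)`. -/
def extendLine (h : (Fin 2 → K) ≃ₗ[K] (Fin 2 → K)) : (Fin 3 → K) ≃ₗ[K] (Fin 3 → K) where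
  toFun x := ![h ![x 0, x 1] 0, h ![x 0, x 1] 1, x 2]
  invFun x := ![h.symm ![x 0, x 1] 0, h.symm ![x 0, x 1] 1, x 2]
  map_add' x y := by
    have : ![(x + y) 0, (x + y) 1] = ![x 0, x 1] + ![y 0, y 1] := by simp
    rw [this, map_add]
    ext j; fin_cases j <;> simp
  map_smul' r x := by
    have : ![(r • x) 0, (r • x) 1] = r • ![x 0, x 1] := by simp
    rw [this, map_smul]
    ext j; fin_cases j <;> simp
  left_inv x := by
    have h2 : ∀ w : Fin 2 → K, ![w 0, w 1] = w := fun w => by ext j; fin_cases j <;> rfl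
    ext j; fin_cases j <;> simp [h2]
  right_inv x := by
    have h2 : ∀ w : Fin 2 → K, ![w 0, w 1] = w := fun w => by ext j; fin_cases j <;> rfl
    ext j; fin_cases j <;> simp [h2]

/-- Normalising the club on the line costs nothing in the plane, since h extends to a map fixing (0,
0, 1). -/
theorem projEquiv_arcOf_map (h : (Fin 2 → K) ≃ₗ[K] (Fin 2 → K)) (U : Submodule F (Fin 2 → K)) :
    ProjEquiv (arcOf (U.map (embedLine F K)) ![0, 0, 1])
      (arcOf ((U.map (h.restrictScalars F : (Fin 2 → K) →ₗ[F] (Fin 2 → K))).map (embedLine F K))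
        ![0, 0, 1]) := by
  refine ⟨extendLine h, ?_⟩
  rw [image_arcOf _ (fun x => rfl)]
  congr 1
  · rw [← Submodule.map_comp, ← Submodule.map_comp]
    congr 1
    refine LinearMap.ext fun w => ?_
    have h2 : ![w 0, w 1] = w := by ext j; fin_cases j <;> rfl
    simp [extendLine, embedLine, h2]
  · have h2 : ![(0 : K), 0] = 0 := by ext j; fin_cases j <;> rfl
    ext j; fin_cases j <;> simp [extendLine, h2]

end Transport

/-! ### Normal form of (n-2)-clubs. -/

section NormalForm

variable {F K : Type*} [Field F] [Field K] [Algebra F K]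

/-- The heavy point ⟨(1, 0)⟩ gives a codimension-two subspace S of K; weight one elsewhere supplies
a ∉ S + bS, as `exists_isClubData` requires. -/
theorem exists_map_eq_clubSpace_of_weight [FiniteDimensional F K] {n : ℕ} (hn : 3 ≤ n)
    (hK : Module.finrank F K = n) {U : Submodule F (Fin 2 → K)} (hU : Module.finrank F U = n)
    {P : ℙ K (Fin 2 → K)} (hP : ∀ w, w ∈ P.submodule ↔ w 1 = 0)
    (hw : weight U P = n - 2) (hw1 : ∀ Q ∈ linearSet K U, Q ≠ P → weight U Q = 1) :
    ∃ (h : (Fin 2 → K) ≃ₗ[K] (Fin 2 → K)) (t l : ℕ) (a b c : K) (T : Submodule F⟮b⟯ K),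
      IsClubData n t l a b c T ∧
      U.map (h.restrictScalars F : (Fin 2 → K) →ₗ[F] (Fin 2 → K)) = clubSpace t a b c T := by
  let ι : K →ₗ[F] (Fin 2 → K) := LinearMap.single F (fun _ : Fin 2 => K) 0
  have hι : ∀ x, ι x = ![x, 0] := fun x => by ext j; fin_cases j <;> simp [ι]
  have hιinj : Function.Injective ι := Pi.single_injective (M := fun _ : Fin 2 => K) 0
  set S₀ : Submodule F K := U.comap ι with hS₀
  have hmem : ∀ x, x ∈ S₀ ↔ ![x, 0] ∈ U := fun x => by rw [hS₀, Submodule.mem_comap, hι]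
  have hmap : S₀.map ι = U ⊓ P.submodule.restrictScalars F := by
    ext w
    rw [Submodule.mem_map, Submodule.mem_inf, Submodule.restrictScalars_mem, hP]
    constructor
    · rintro ⟨x, hx, rfl⟩
      exact ⟨hx, by simp [hι]⟩
    · rintro ⟨h1, h2⟩
      have : ι (w 0) = w := by rw [hι]; ext j; fin_cases j <;> simp [h2]
      exact ⟨w 0, by rw [hS₀, Submodule.mem_comap, this]; exact h1, this⟩
  have hS₀rank : Module.finrank F S₀ = n - 2 := by
    rw [← hw, weight, ← hmap, (Submodule.equivMapOfInjective ι hιinj S₀).finrank_eq]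
  -- The kernel of the second coordinate on U is the part in the heavy point, so its image has
  -- dimension n - (n - 2) = 2.
  let π : U →ₗ[F] K := (LinearMap.proj (R := F) (φ := fun _ : Fin 2 => K) 1).domRestrict U
  have hker : Module.finrank F π.ker = n - 2 := by
    rw [← hw, weight, ← Submodule.finrank_map_subtype_eq U π.ker]
    suffices π.ker.map U.subtype = U ⊓ P.submodule.restrictScalars F by rw [this]
    ext w
    rw [Submodule.mem_inf, Submodule.restrictScalars_mem, hP]
    simp only [Submodule.mem_map, LinearMap.mem_ker, Submodule.coe_subtype, Subtype.exists]
    constructor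
    · rintro ⟨u, hu, h, rfl⟩
      exact ⟨hu, h⟩
    · rintro ⟨h1, h2⟩
      exact ⟨w, h1, h2, rfl⟩
  have hrange : Module.finrank F π.range = 2 := by
    have := LinearMap.finrank_range_add_finrank_ker π
    omega
  let B := Module.finBasisOfFinrankEq F π.range hrange
  obtain ⟨⟨w₁, hw₁⟩, hy₁⟩ := (B 0).2
  obtain ⟨⟨w₂, hw₂⟩, hy₂⟩ := (B 1).2
  replace hy₁ : w₁ 1 = B 0 := hy₁
  replace hy₂ : w₂ 1 = B 1 := hy₂
  have hgen : ∀ u ∈ U, ∃ α β : F, u 1 = algebraMap F K α * w₁ 1 + algebraMap F K β * w₂ 1 := by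
    intro u hu
    have := B.sum_repr ⟨u 1, ⟨u, hu⟩, rfl⟩
    rw [Fin.sum_univ_two] at this
    have := congrArg (Subtype.val) this
    simp only [Submodule.coe_add, Submodule.coe_smul, ← hy₁, ← hy₂, Algebra.smul_def] at this
    exact ⟨_, _, this.symm⟩
  have hy0 : w₁ 1 ≠ 0 := by
    rw [hy₁]
    exact fun h => B.ne_zero 0 (Subtype.ext h)
  set b : K := w₂ 1 / w₁ 1 with hbdef
  have hb : b ∉ (⊥ : IntermediateField F K) := by
    rintro hb
    obtain ⟨k, hk⟩ := IntermediateField.mem_bot.1 hb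
    have h2 : w₂ 1 = k • w₁ 1 := by
      rw [Algebra.smul_def, hk, hbdef]
      field_simp
    have h3 : B 1 = k • B 0 := Subtype.ext (by rw [Submodule.coe_smul, ← hy₁, ← hy₂, h2])
    have h4 := congrArg (fun x => B.repr x 1) h3
    simp at h4
  have hby : w₂ 1 = b * w₁ 1 := by rw [hbdef]; field_simp
  -- Uses n ≥ 3; dividing by s₀ puts 1 into S.
  obtain ⟨s₀, hs₀, hs0⟩ : ∃ s ∈ S₀, s ≠ 0 := by
    refine Submodule.exists_mem_ne_zero_of_ne_bot fun h => ?_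
    rw [h, finrank_bot] at hS₀rank
    omega
  set a : K := s₀⁻¹ * (w₂ 0 - w₁ 0 * b) with ha
  set S : Submodule F K := S₀.map (LinearMap.mulLeft F s₀⁻¹) with hS
  have hmulinj : Function.Injective (LinearMap.mulLeft F s₀⁻¹) :=
    fun x y h => mul_left_cancel₀ (inv_ne_zero hs0) h
  have hSrank : Module.finrank F S + 2 = Module.finrank F K := by
    rw [hS, ← (Submodule.equivMapOfInjective _ hmulinj S₀).finrank_eq, hS₀rank, hK]
    omega
  have h1S : (1 : K) ∈ S := ⟨s₀, hs₀, by simp [hs0]⟩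
  -- Otherwise u = w₁ + (s', 0) and b u = w₂ - (s, 0) both lie in U. Their common point is not P, so
  -- it has weight one, forcing b into F.
  have haS : a ∉ S ⊔ S.map (LinearMap.mulLeft F b) := by
    intro h
    obtain ⟨_, ⟨s, hs, rfl⟩, _, ⟨_, ⟨s', hs', rfl⟩, rfl⟩, h⟩ := Submodule.mem_sup.1 h
    simp only [LinearMap.mulLeft_apply] at h
    have h0 : w₂ 0 = w₁ 0 * b + s + b * s' := by
      rw [ha] at h
      field_simp at h
      linear_combination -h
    have hu₁ : ![w₁ 0 + s', w₁ 1] ∈ U := by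
      have := U.add_mem hw₁ ((hmem s').1 hs')
      convert this using 1
      ext j; fin_cases j <;> simp
    have hu₂ : b • ![w₁ 0 + s', w₁ 1] ∈ U := by
      have := U.sub_mem hw₂ ((hmem s).1 hs)
      convert this using 1
      ext j; fin_cases j
      · simp only [Fin.zero_eta, Pi.smul_apply, Matrix.cons_val_zero, smul_eq_mul, Pi.sub_apply]
        rw [h0]; ring
      · simp [hby]
    set u := ![w₁ 0 + s', w₁ 1] with hu
    have hu0 : u ≠ 0 := fun h => hy0 (by simpa [hu] using congrFun h 1)
    have hQ := hw1 (Projectivization.mk K u hu0) ⟨u, hu0, hu₁, rfl⟩ (by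
      rintro rfl
      have := (hP u).1 (by
        rw [Projectivization.submodule_mk]; exact Submodule.mem_span_singleton_self u)
      exact hy0 (by simpa [hu] using this))
    rw [weight] at hQ
    have hmem' : ∀ k : K, k • u ∈ U → k • u ∈
        U ⊓ (Projectivization.mk K u hu0).submodule.restrictScalars F := fun k hk => by
      refine ⟨hk, ?_⟩
      rw [Projectivization.submodule_mk]
      exact Submodule.smul_mem _ _ (Submodule.mem_span_singleton_self u)
    have hu₁' := hmem' 1 (by rwa [one_smul])
    rw [one_smul] at hu₁'
    obtain ⟨r, hr⟩ := (finrank_eq_one_iff_of_nonzero' (⟨u, hu₁'⟩ : ↥(U ⊓ _))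
      (fun h => hu0 (congrArg Subtype.val h))).1 hQ ⟨b • u, hmem' b hu₂⟩
    have hr' : r • u = b • u := congrArg Subtype.val hr
    have := congrFun hr' 1
    simp only [hu, Pi.smul_apply, Matrix.cons_val_one, Matrix.cons_val_zero, Algebra.smul_def] at this
    exact hb (IntermediateField.mem_bot.2 ⟨r, by simpa [hy0] using this⟩)
  obtain ⟨t, l, c, T, hdata, hT⟩ := exists_isClubData hSrank h1S hb haS
  -- Sends (s₀, 0), w₁, w₂ to (1, 0), (0, 1), (a, b).
  let h : (Fin 2 → K) ≃ₗ[K] (Fin 2 → K) :=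
    { toFun := fun x => ![s₀⁻¹ * (x 0 - w₁ 0 / w₁ 1 * x 1), x 1 / w₁ 1]
      invFun := fun x => ![s₀ * x 0 + w₁ 0 * x 1, w₁ 1 * x 1]
      map_add' := fun x y => by
        ext j; fin_cases j
        · simp; ring
        · simp; ring
      map_smul' := fun r x => by
        ext j; fin_cases j
        · simp; ring
        · simp; ring
      left_inv := fun x => by
        ext j; fin_cases j
        · simp; field_simp; ring
        · simp; field_simp
      right_inv := fun x => by
        ext j; fin_cases j
        · simp; field_simp; ring
        · simp; field_simp }
  have hh : ∀ x, h x = ![s₀⁻¹ * (x 0 - w₁ 0 / w₁ 1 * x 1), x 1 / w₁ 1] := fun x => rfl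
  refine ⟨h, t, l, a, b, c, T, hK ▸ hdata, ?_⟩
  ext w
  rw [mem_clubSpace, hT]
  constructor
  · rintro ⟨u, hu, rfl⟩
    obtain ⟨α, β, hαβ⟩ := hgen u hu
    have hs : u 0 - algebraMap F K α * w₁ 0 - algebraMap F K β * w₂ 0 ∈ S₀ := by
      rw [hmem]
      have := U.sub_mem (U.sub_mem hu (U.smul_mem α hw₁)) (U.smul_mem β hw₂)
      convert this using 1
      ext j; fin_cases j
      · simp [Algebra.smul_def]
      · simp [Algebra.smul_def, hαβ]
    -- The normal form uses (1, 1) where h gives (0, 1); the difference α is absorbed in S because 1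
    -- ∈ S.
    refine ⟨s₀⁻¹ * (u 0 - algebraMap F K α * w₁ 0 - algebraMap F K β * w₂ 0) - algebraMap F K α,
      S.sub_mem ⟨_, hs, rfl⟩ ?_, α, β, ?_⟩
    · rw [← mul_one (algebraMap F K α), ← Algebra.smul_def]
      exact S.smul_mem _ h1S
    · change h u = _
      rw [hh, hαβ, hby, ha]
      ext j; fin_cases j
      · simp; field_simp; ring
      · simp; field_simp
  · rintro ⟨_, ⟨s, hs, rfl⟩, α, β, rfl⟩
    refine ⟨![s, 0] + α • ![s₀, 0] + α • w₁ + β • w₂, ?_, ?_⟩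
    · exact U.add_mem (U.add_mem (U.add_mem ((hmem s).1 hs) (U.smul_mem _ ((hmem _).1 hs₀)))
        (U.smul_mem _ hw₁)) (U.smul_mem _ hw₂)
    · change h _ = _
      have hx₀ : (![s, 0] + α • ![s₀, 0] + α • w₁ + β • w₂) 0 =
          s + algebraMap F K α * s₀ + algebraMap F K α * w₁ 0 + algebraMap F K β * w₂ 0 := by
        simp only [Pi.add_apply, Pi.smul_apply, Matrix.cons_val_zero]
        simp only [Algebra.smul_def]
      have hx₁ : (![s, 0] + α • ![s₀, 0] + α • w₁ + β • w₂) 1 =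
          algebraMap F K α * w₁ 1 + algebraMap F K β * (b * w₁ 1) := by
        simp only [Pi.add_apply, Pi.smul_apply, Matrix.cons_val_one, Matrix.cons_val_fin_one, hby,
          smul_zero, zero_add]
        simp only [Algebra.smul_def]
      rw [hh, ha, hx₀, hx₁]
      ext j; fin_cases j
      · simp; field_simp; ring
      · simp; field_simp

/-- Every `(n-2)`-club of rank `n` is projectively equivalent to one in normal form. -/
theorem IsClub.exists_map_eq_clubSpace [FiniteDimensional F K] {n : ℕ} (hn : 3 ≤ n)
    (hK : Module.finrank F K = n) {U : Submodule F (Fin 2 → K)} (hU : Module.finrank F U = n)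
    (hclub : IsClub (n - 2) U) :
    ∃ (h : (Fin 2 → K) ≃ₗ[K] (Fin 2 → K)) (t l : ℕ) (a b c : K) (T : Submodule F⟮b⟯ K),
      IsClubData n t l a b c T ∧
      U.map (h.restrictScalars F : (Fin 2 → K) →ₗ[F] (Fin 2 → K)) = clubSpace t a b c T := by
  obtain ⟨P, hP, hw, hw1⟩ := hclub
  have he : (![1, 0] : Fin 2 → K) ≠ 0 := fun h => one_ne_zero (congrFun h 0)
  have := MulAction.isPretransitive_of_is_two_pretransitive
    (G := (Fin 2 → K) ≃ₗ[K] (Fin 2 → K)) (α := ℙ K (Fin 2 → K))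
  obtain ⟨g, hg⟩ := MulAction.exists_smul_eq ((Fin 2 → K) ≃ₗ[K] (Fin 2 → K)) P
    (Projectivization.mk K _ he)
  obtain ⟨h, t, l, a, b, c, T, hdata, hT⟩ := exists_map_eq_clubSpace_of_weight hn hK
    (U := U.map (g.restrictScalars F : (Fin 2 → K) →ₗ[F] (Fin 2 → K))) (P := g • P)
    (by rw [LinearEquiv.finrank_map_eq, hU])
    (fun w => by
      rw [hg, Projectivization.submodule_mk, Submodule.mem_span_singleton]
      constructor
      · rintro ⟨k, rfl⟩
        simp
      · intro h
        exact ⟨w 0, by ext j; fin_cases j <;> simp [h]⟩)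
    (by rw [weight_map_smul, hw])
    (fun Q hQ hne => by
      obtain ⟨R, rfl⟩ : ∃ R, g • R = Q := ⟨g⁻¹ • Q, by simp⟩
      rw [weight_map_smul]
      exact hw1 R ((smul_mem_linearSet_map g).1 hQ) fun h => hne (by rw [h]))
  refine ⟨g.trans h, t, l, a, b, c, T, hdata, ?_⟩
  rw [← hT, ← Submodule.map_comp]
  rfl

end NormalForm

/-! ### Elations as translations, and coordinates adapted to the axis. -/

section Elations

variable {K V : Type*} [Field K] [AddCommGroup V] [Module K V]

/-- The nonzero vectors that represent the points of `A`. -/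
def cone (A : Set (ℙ K V)) : Set V := {v | ∃ h : v ≠ 0, Projectivization.mk K v h ∈ A}

theorem mk_mem_iff_mem_cone {A : Set (ℙ K V)} {v : V} (hv : v ≠ 0) :
    Projectivization.mk K v hv ∈ A ↔ v ∈ cone A :=
  ⟨fun h => ⟨hv, h⟩, fun ⟨_, h⟩ => h⟩

theorem smul_mem_cone {A : Set (ℙ K V)} {k : K} (hk : k ≠ 0) {v : V} :
    k • v ∈ cone A ↔ v ∈ cone A := by
  have key : ∀ (hv : v ≠ 0) (hkv : k • v ≠ 0),
      Projectivization.mk K (k • v) hkv = Projectivization.mk K v hv := fun hv hkv =>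
    (Projectivization.mk_eq_mk_iff' K _ _ _ _).2 ⟨k, rfl⟩
  constructor
  · rintro ⟨h, hA⟩
    have hv : v ≠ 0 := (smul_ne_zero_iff.1 h).2
    exact ⟨hv, key hv h ▸ hA⟩
  · rintro ⟨h, hA⟩
    have hkv := smul_ne_zero hk h
    exact ⟨hkv, (key h hkv).symm ▸ hA⟩

theorem isLine_span_pair {u v : V} (h : LinearIndependent K ![u, v]) :
    IsLine (Submodule.span K {u, v}) := by
  rw [IsLine, ← Matrix.range_cons_cons_empty u v ![], finrank_span_eq_card h, Fintype.card_fin]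

/-- An elation acts on its axis by a scalar, the same one as off the axis. -/
theorem IsElation.apply_eq_smul {W : Submodule K V} (hW : IsLine W) {g : V ≃ₗ[K] V}
    (hg : IsElation W g) {v w₁ : V} (hv : v ∉ W) (hw₁ : w₁ ∈ W) {μ : K}
    (h : g v = μ • (v + w₁)) : ∀ w ∈ W, g w = μ • w := by
  obtain ⟨hfix, C, hC, hlines⟩ := hg
  induction C using Projectivization.ind with
  | h c hc =>
  rw [mk_mem_points] at hC
  have hcoef : ∀ x : K, x • v ∈ W → x = 0 := fun x hx => by
    by_contra h0
    exact hv ((W.smul_mem_iff h0).1 hx)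
  have heig : ∀ w ∈ W, ∃ k : K, g w = k • w := by
    intro w hw
    by_cases h0 : w = 0
    · exact ⟨0, by simp [h0]⟩
    · have := hfix (Projectivization.mk K w h0) ((mk_mem_points h0).2 hw)
      rw [Projectivization.smul_mk, Projectivization.mk_eq_mk_iff'] at this
      obtain ⟨k, hk⟩ := this
      exact ⟨k, hk.symm⟩
  have hline : ∀ u, u ∉ W → ∃ x y : K, x • u + y • c = g u := by
    intro u hu
    have hli : LinearIndependent K ![u, c] := by
      rw [LinearIndependent.pair_iff]
      intro x y hxy
      have hx : x = 0 := by
        by_contra h0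
        refine hu ((W.smul_mem_iff h0).1 ?_)
        rw [eq_neg_of_add_eq_zero_left hxy]
        exact W.neg_mem (W.smul_mem _ hC)
      subst hx
      rw [zero_smul, zero_add, smul_eq_zero] at hxy
      exact ⟨rfl, hxy.resolve_right hc⟩
    have hM := hlines _ (isLine_span_pair hli)
      ((mk_mem_points hc).2 (Submodule.subset_span (by simp)))
    rw [← Submodule.mem_span_pair, ← hM]
    exact Submodule.mem_map_of_mem (Submodule.subset_span (by simp))
  -- The line through v and the centre is fixed, so the displacement of v points towards the centre.
  have hw₁c : μ • w₁ ∈ Submodule.span K {c} := by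
    obtain ⟨x, y, hxy⟩ := hline v hv
    rw [h] at hxy
    have h1 : (x - μ) • v = μ • w₁ - y • c := by
      rw [sub_smul, eq_sub_of_add_eq hxy]; module
    have h2 : x - μ = 0 := hcoef _ (h1 ▸ W.sub_mem (W.smul_mem _ hw₁) (W.smul_mem _ hC))
    rw [h2, zero_smul, eq_comm, sub_eq_zero] at h1
    rw [h1]
    exact Submodule.smul_mem _ _ (Submodule.mem_span_singleton_self c)
  -- The line joining v + w to the centre is fixed. Comparing coefficients modulo W, then modulo c,
  -- identifies the eigenvalue of w with μ.
  have hout : ∀ w ∈ W, w ∉ Submodule.span K {c} → g w = μ • w := by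
    intro w hw hwc
    obtain ⟨k, hk⟩ := heig w hw
    have hvw : v + w ∉ W := fun h => hv ((Submodule.add_mem_iff_left W hw).1 h)
    obtain ⟨x, y, hxy⟩ := hline _ hvw
    rw [map_add, h, hk] at hxy
    have h1 : (x - μ) • v = μ • w₁ + k • w - x • w - y • c := by
      have : x • v = μ • (v + w₁) + k • w - y • c - x • w := by rw [← hxy]; module
      rw [sub_smul, this]; module
    have h2 : x - μ = 0 := hcoef _ (h1 ▸ W.sub_mem (W.sub_mem (W.add_mem (W.smul_mem _ hw₁)
      (W.smul_mem _ hw)) (W.smul_mem _ hw)) (W.smul_mem _ hC))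
    rw [h2, zero_smul] at h1
    obtain rfl : x = μ := sub_eq_zero.1 h2
    have h3 : (x - k) • w = x • w₁ - y • c := by
      rw [sub_smul, ← sub_eq_zero, ← neg_eq_zero, h1]; module
    have h4 : (x - k) • w ∈ Submodule.span K {c} := by
      rw [h3]
      exact Submodule.sub_mem _ hw₁c
        (Submodule.smul_mem _ _ (Submodule.mem_span_singleton_self c))
    have h5 : x - k = 0 := by
      by_contra h0
      exact hwc ((Submodule.smul_mem_iff _ h0).1 h4)
    rw [hk, ← sub_eq_zero.1 h5]
  obtain ⟨w₀, hw₀, hw₀c⟩ : ∃ w ∈ W, w ∉ Submodule.span K {c} := by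
    by_contra! hcon
    have := Submodule.finrank_mono (show W ≤ Submodule.span K {c} from hcon)
    rw [finrank_span_singleton hc, hW] at this
    omega
  intro w hw
  by_cases hwc : w ∈ Submodule.span K {c}
  -- Vectors over the centre are differences of two vectors of W not over it.
  · have h1 := hout (w₀ + w) (W.add_mem hw₀ hw)
      fun h => hw₀c ((Submodule.add_mem_iff_left _ hwc).1 h)
    rw [map_add, hout w₀ hw₀ hw₀c, smul_add] at h1
    exact add_left_cancel h1
  · exact hout w hw hwc

/-- If elations with axis `W` stabilising `A` act transitively on `A \ W`, then the vectors of `W`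
that translate a given point of `A \ W` into `A` are closed under addition. -/
theorem add_mem_cone_of_transitive {W : Submodule K V} (hW : IsLine W) {A : Set (ℙ K V)}
    (hA : ∀ P ∈ A \ points W, ∀ Q ∈ A \ points W, ∃ g : V ≃ₗ[K] V,
      IsElation W g ∧ (fun R : ℙ K V => g • R) '' A = A ∧ g • P = Q)
    {v w₁ w₂ : V} (hv : v ∉ W) (hw₁ : w₁ ∈ W) (hw₂ : w₂ ∈ W) (hvA : v ∈ cone A)
    (h₁ : v + w₁ ∈ cone A) (h₂ : v + w₂ ∈ cone A) : v + (w₁ + w₂) ∈ cone A := by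
  obtain ⟨hv0, hvA⟩ := hvA
  obtain ⟨h₁0, h₁⟩ := h₁
  obtain ⟨h₂0, h₂⟩ := h₂
  obtain ⟨g, hg, hgA, hgv⟩ := hA _ ⟨hvA, fun h => hv ((mk_mem_points hv0).1 h)⟩ _ ⟨h₁, fun h =>
    hv ((Submodule.add_mem_iff_left W hw₁).1 ((mk_mem_points h₁0).1 h))⟩
  rw [Projectivization.smul_mk, Projectivization.mk_eq_mk_iff'] at hgv
  obtain ⟨μ, hμ⟩ := hgv
  replace hμ : g v = μ • (v + w₁) := hμ.symm
  have hμ0 : μ ≠ 0 := by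
    rintro rfl
    rw [zero_smul, map_eq_zero_iff g g.injective] at hμ
    exact hv0 hμ
  have hmem : g • Projectivization.mk K (v + w₂) h₂0 ∈ A := by
    rw [← hgA]
    exact ⟨_, h₂, rfl⟩
  rw [Projectivization.smul_mk, mk_mem_iff_mem_cone] at hmem
  -- The elation moving v to v + w₁ also adds w₁ to v + w₂, up to the common scalar.
  have : g • (v + w₂) = μ • (v + (w₁ + w₂)) := by
    rw [LinearEquiv.smul_def, map_add, hμ, hg.apply_eq_smul hW hv hw₁ hμ w₂ hw₂]
    module
  rwa [this, smul_mem_cone hμ0] at hmem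

theorem IsKMArc.preimage_smul {t : ℕ} {A : Set (ℙ K (Fin 3 → K))} (hA : IsKMArc t A)
    (g : (Fin 3 → K) ≃ₗ[K] (Fin 3 → K)) : IsKMArc t {P | g • P ∈ A} := by
  have key : ∀ B : Set (ℙ K (Fin 3 → K)), {P | g • P ∈ B}.ncard = B.ncard := fun B =>
    Set.ncard_preimage_of_injective_subset_range (f := fun P : ℙ K (Fin 3 → K) => g • P)
      (MulAction.injective g) fun Q _ => ⟨g⁻¹ • Q, by simp⟩
  refine ⟨by rw [key, hA.1], fun W hW => ?_⟩
  have : {P | g • P ∈ A} ∩ points W =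
      {P | g • P ∈ A ∩ points (W.map (g : (Fin 3 → K) →ₗ[K] (Fin 3 → K)))} := by
    ext P
    exact and_congr Iff.rfl (smul_mem_points_map g P).symm
  rw [this, key]
  refine hA.2 _ ?_
  rw [IsLine, LinearEquiv.finrank_map_eq]
  exact hW

/-- Coordinates in which a given line is `X₂ = 0` and a given point off it is `(0, 0, 1)`. -/
theorem exists_coordinates {W : Submodule K (Fin 3 → K)} (hW : IsLine W) {v : Fin 3 → K}
    (hv : v ∉ W) : ∃ (g : (Fin 3 → K) ≃ₗ[K] (Fin 3 → K)) (ι : (Fin 2 → K) →ₗ[K] (Fin 3 → K)),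
      (∀ u, ι u ∈ W) ∧ ∀ u z, g ![u 0, u 1, z] = ι u + z • v := by
  have : Module.Finite K W := inferInstance
  let B := Module.finBasisOfFinrankEq K W hW
  let ι : (Fin 2 → K) →ₗ[K] (Fin 3 → K) := W.subtype ∘ₗ (B.equivFun.symm : (Fin 2 → K) →ₗ[K] W)
  have hιW : ∀ u, ι u ∈ W := fun u => (B.equivFun.symm u).2
  have hιinj : Function.Injective ι :=
    W.injective_subtype.comp B.equivFun.symm.injective
  let G : (Fin 3 → K) →ₗ[K] (Fin 3 → K) :=
    ι ∘ₗ LinearMap.funLeft K K ![0, 1] + (LinearMap.proj 2).smulRight v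
  have hG : ∀ x, G x = ι ![x 0, x 1] + x 2 • v := by
    intro x
    have : LinearMap.funLeft K K ![0, 1] x = ![x 0, x 1] := by
      ext j; fin_cases j <;> simp [LinearMap.funLeft]
    simp [G, this]
  have hGinj : Function.Injective G := by
    rw [← LinearMap.ker_eq_bot, LinearMap.ker_eq_bot']
    intro x hx
    rw [hG] at hx
    have h2 : x 2 = 0 := by
      by_contra h0
      refine hv ((W.smul_mem_iff h0).1 ?_)
      rw [eq_neg_of_add_eq_zero_right hx]
      exact W.neg_mem (hιW _)
    rw [h2, zero_smul, add_zero, map_eq_zero_iff _ hιinj] at hx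
    have hx0 := congrFun hx 0
    have hx1 := congrFun hx 1
    ext j; fin_cases j
    · exact hx0
    · exact hx1
    · exact h2
  refine ⟨LinearEquiv.ofInjectiveEndo G hGinj, ι, hιW, fun u z => ?_⟩
  rw [LinearEquiv.coe_ofInjectiveEndo, hG]
  have : ![(![u 0, u 1, z] : Fin 3 → K) 0, (![u 0, u 1, z] : Fin 3 → K) 1] = u := by
    ext j; fin_cases j <;> rfl
  rw [this]; rfl

end Elations

/-! ### Affine points, points at infinity, and lines through the origin. -/

section PlaneCoordinates

variable {K : Type*} [Field K]

theorem affineVector_ne_zero (u : Fin 2 → K) : ![u 0, u 1, 1] ≠ 0 :=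
  fun h => one_ne_zero (congrFun h 2)

/-- The point of the plane off the line `X₂ = 0` with affine coordinates `u`. -/
def affinePoint (u : Fin 2 → K) : ℙ K (Fin 3 → K) :=
  Projectivization.mk K ![u 0, u 1, 1] (affineVector_ne_zero u)

theorem mk_eq_affinePoint_iff {x : Fin 3 → K} (hx : x ≠ 0) {u : Fin 2 → K} :
    Projectivization.mk K x hx = affinePoint u ↔ x 0 = x 2 * u 0 ∧ x 1 = x 2 * u 1 := by
  rw [affinePoint, Projectivization.mk_eq_mk_iff']
  constructor
  · rintro ⟨k, rfl⟩
    simp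
  · rintro ⟨h0, h1⟩
    exact ⟨x 2, by ext j; fin_cases j <;> simp [h0, h1]⟩

theorem affinePoint_injective : Function.Injective (affinePoint (K := K)) := by
  intro u v h
  have := (mk_eq_affinePoint_iff (affineVector_ne_zero u)).1 h
  ext j; fin_cases j
  · simpa using this.1
  · simpa using this.2

theorem affinePoint_notMem (u : Fin 2 → K) : affinePoint u ∉ points (lineX2 K) := by
  rw [affinePoint, mk_mem_points]
  simp [lineX2]

theorem exists_eq_affinePoint {P : ℙ K (Fin 3 → K)} (hP : P ∉ points (lineX2 K)) :
    ∃ u, P = affinePoint u := by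
  induction P using Projectivization.ind with
  | h x hx =>
    rw [mk_mem_points] at hP
    have h2 : x 2 ≠ 0 := hP
    refine ⟨![x 0 / x 2, x 1 / x 2], (mk_eq_affinePoint_iff hx).2 ?_⟩
    constructor
    · simp; field_simp
    · simp; field_simp

theorem embedLine_injective : Function.Injective (embedLine K K) := by
  intro u v h
  ext j; fin_cases j
  · exact congrFun h 0
  · exact congrFun h 1

/-- The embedding of the projective line as the line `X₂ = 0` of the plane. -/
def linePoint : ℙ K (Fin 2 → K) → ℙ K (Fin 3 → K) :=
  Projectivization.map (embedLine K K) embedLine_injective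

theorem linePoint_injective : Function.Injective (linePoint (K := K)) :=
  Projectivization.map_injective _ embedLine_injective

theorem linePoint_mk {v : Fin 2 → K} (hv : v ≠ 0) :
    linePoint (Projectivization.mk K v hv) = Projectivization.mk K (embedLine K K v)
      (fun h => hv (embedLine_injective (h.trans (map_zero _).symm))) := rfl

theorem range_linePoint : Set.range (linePoint (K := K)) = points (lineX2 K) := by
  ext P
  constructor
  · rintro ⟨Q, rfl⟩
    induction Q using Projectivization.ind with
    | h v hv =>
      rw [linePoint_mk, mk_mem_points]
      simp [lineX2, embedLine]
  · intro hP
    induction P using Projectivization.ind with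
    | h x hx =>
      rw [mk_mem_points] at hP
      have h2 : x 2 = 0 := hP
      have hx' : embedLine K K ![x 0, x 1] = x := by
        ext j; fin_cases j <;> simp [embedLine, h2]
      have h0 : (![x 0, x 1] : Fin 2 → K) ≠ 0 := fun h => hx (by rw [← hx', h, map_zero])
      refine ⟨Projectivization.mk K _ h0, ?_⟩
      rw [linePoint_mk]
      congr 1

theorem isLine_lineX2 : IsLine (lineX2 K) := by
  have h := Module.Dual.finrank_ker_add_one_of_ne_zero
    (f := LinearMap.proj (R := K) (φ := fun _ : Fin 3 => K) 2) (fun h =>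
      one_ne_zero (LinearMap.congr_fun h (Pi.single 2 (1 : K)) |> (by simp : _ → (1 : K) = 0)))
  rw [Module.finrank_fin_fun] at h
  have : Module.finrank K (lineX2 K) + 1 = 3 := h
  rw [IsLine]; omega

/-- The line joining a point of the line `X₂ = 0` to `(0, 0, 1)`. -/
def joinOrigin (P : ℙ K (Fin 2 → K)) : Submodule K (Fin 3 → K) :=
  P.submodule.comap (LinearMap.funLeft K K ![0, 1])

theorem mem_joinOrigin {P : ℙ K (Fin 2 → K)} {x : Fin 3 → K} :
    x ∈ joinOrigin P ↔ ![x 0, x 1] ∈ P.submodule := by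
  have : LinearMap.funLeft K K ![0, 1] x = ![x 0, x 1] := by
    ext j; fin_cases j <;> simp [LinearMap.funLeft]
  rw [joinOrigin, Submodule.mem_comap, this]

theorem isLine_joinOrigin (P : ℙ K (Fin 2 → K)) : IsLine (joinOrigin P) := by
  induction P using Projectivization.ind with
  | h v hv =>
  have : joinOrigin (Projectivization.mk K v hv) =
      Submodule.span K {embedLine K K v, ![0, 0, 1]} := by
    ext x
    rw [mem_joinOrigin, Projectivization.submodule_mk, Submodule.mem_span_singleton,
      Submodule.mem_span_pair]
    constructor
    · rintro ⟨k, hk⟩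
      refine ⟨k, x 2, ?_⟩
      have h0 := congrFun hk 0
      have h1 := congrFun hk 1
      ext j; fin_cases j
      · simpa [embedLine] using h0
      · simpa [embedLine] using h1
      · simp [embedLine]
    · rintro ⟨k, z, rfl⟩
      exact ⟨k, by ext j; fin_cases j <;> simp [embedLine]⟩
  rw [this]
  refine isLine_span_pair (LinearIndependent.pair_iff.2 fun k z h => ?_)
  have hz : z = 0 := by simpa [embedLine] using congrFun h 2
  subst hz
  rw [zero_smul, add_zero, ← map_smul, map_eq_zero_iff _ embedLine_injective, smul_eq_zero] at h
  exact ⟨h.resolve_right hv, rfl⟩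

theorem affinePoint_mem_joinOrigin {P : ℙ K (Fin 2 → K)} {u : Fin 2 → K} :
    affinePoint u ∈ points (joinOrigin P) ↔ u ∈ P.submodule := by
  have : ![(![u 0, u 1, 1] : Fin 3 → K) 0, (![u 0, u 1, 1] : Fin 3 → K) 1] = u := by
    ext j; fin_cases j <;> rfl
  rw [affinePoint, mk_mem_points, mem_joinOrigin, this]

theorem mem_submodule_iff {V : Type*} [AddCommGroup V] [Module K V] {v : V} (hv : v ≠ 0)
    {P : ℙ K V} : v ∈ P.submodule ↔ Projectivization.mk K v hv = P := by
  induction P using Projectivization.ind with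
  | h w hw =>
    rw [Projectivization.submodule_mk, Submodule.mem_span_singleton,
      Projectivization.mk_eq_mk_iff']

theorem linePoint_mem_joinOrigin {P Q : ℙ K (Fin 2 → K)} :
    linePoint Q ∈ points (joinOrigin P) ↔ Q = P := by
  induction Q using Projectivization.ind with
  | h v hv =>
    have : ![embedLine K K v 0, embedLine K K v 1] = v := by
      ext j; fin_cases j <;> rfl
    rw [linePoint_mk, mk_mem_points, mem_joinOrigin, this, mem_submodule_iff hv]

end PlaneCoordinates

/-! ### The arc of U, read off its affine points and points at infinity. -/

section ArcOf

variable {F K : Type*} [Field F] [Field K] [Algebra F K]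

theorem linePoint_mem_linearSet {U : Submodule F (Fin 2 → K)} {P : ℙ K (Fin 2 → K)} :
    linePoint P ∈ linearSet K (U.map (embedLine F K)) ↔ P ∈ linearSet K U := by
  constructor
  · rintro ⟨_, h0, ⟨u, hu, rfl⟩, h⟩
    have hu0 : u ≠ 0 := by rintro rfl; simp at h0
    refine ⟨u, hu0, hu, linePoint_injective ?_⟩
    rw [h, linePoint_mk]
    rfl
  · rintro ⟨u, hu0, hu, rfl⟩
    exact ⟨embedLine F K u, fun h => hu0 (embedLine_injective (h.trans (map_zero _).symm)),
      ⟨u, hu, rfl⟩, rfl⟩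

/-- A vector of U' off the line has last coordinate r in F, and dividing by r stays inside U. -/
theorem affinePoint_mem_linearSet {U : Submodule F (Fin 2 → K)} {u : Fin 2 → K} :
    affinePoint u ∈ linearSet K (U.map (embedLine F K) ⊔ Submodule.span F {![0, 0, 1]}) ↔
      u ∈ U := by
  constructor
  · rintro ⟨x, h0, hx, h⟩
    obtain ⟨_, ⟨v, hv, rfl⟩, _, hz, rfl⟩ := Submodule.mem_sup.1 hx
    obtain ⟨r, rfl⟩ := Submodule.mem_span_singleton.1 hz
    obtain ⟨h1, h2⟩ := (mk_eq_affinePoint_iff h0).1 h.symm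
    have e0 : v 0 = algebraMap F K r * u 0 := by
      simpa [embedLine, Algebra.algebraMap_eq_smul_one] using h1
    have e1 : v 1 = algebraMap F K r * u 1 := by
      simpa [embedLine, Algebra.algebraMap_eq_smul_one] using h2
    have hvu : v = r • u := by
      ext j; fin_cases j
      · rw [Pi.smul_apply, Algebra.smul_def]; exact e0
      · rw [Pi.smul_apply, Algebra.smul_def]; exact e1
    have hr : r ≠ 0 := by
      rintro rfl
      apply h0
      rw [hvu]
      simp
    rw [hvu] at hv
    exact (U.smul_mem_iff hr).1 hv
  · intro hu
    refine ⟨_, affineVector_ne_zero u, ?_, rfl⟩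
    have : ![u 0, u 1, 1] = embedLine F K u + ![0, 0, 1] := by
      ext j; fin_cases j <;> simp [embedLine]
    rw [this]
    exact Submodule.add_mem_sup ⟨u, hu, rfl⟩ (Submodule.mem_span_singleton_self _)

theorem eq_arcOf {A : Set (ℙ K (Fin 3 → K))} {U : Submodule F (Fin 2 → K)}
    (h₁ : ∀ u, affinePoint u ∈ A ↔ u ∈ U) (h₂ : ∀ P, linePoint P ∈ A ↔ P ∉ linearSet K U) :
    A = arcOf (U.map (embedLine F K)) ![0, 0, 1] := by
  ext P
  by_cases hP : P ∈ points (lineX2 K)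
  · obtain ⟨Q, rfl⟩ : P ∈ Set.range linePoint := by rwa [range_linePoint]
    simp [arcOf, hP, h₂, linePoint_mem_linearSet]
  · obtain ⟨u, rfl⟩ := exists_eq_affinePoint hP
    simp [arcOf, hP, h₁, affinePoint_mem_linearSet]

end ArcOf

/-! ### Counting vectors of U by weight. -/

section Counting

variable {F K V : Type*} [Field F] [Field K] [Algebra F K]
  [AddCommGroup V] [Module K V] [Module F V] [IsScalarTower F K V]

theorem natCard_inf_submodule [Finite V] (U : Submodule F V) (P : ℙ K V) :
    Nat.card ↥(U ⊓ P.submodule.restrictScalars F) = Nat.card F ^ weight U P := by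
  have : Module.Finite F ↥(U ⊓ P.submodule.restrictScalars F) := Module.Finite.of_finite
  exact Module.natCard_eq_pow_finrank

theorem weight_ne_zero_iff [Finite V] {U : Submodule F V} {P : ℙ K V} :
    weight U P ≠ 0 ↔ P ∈ linearSet K U := by
  have : Module.Finite F ↥(U ⊓ P.submodule.restrictScalars F) := Module.Finite.of_finite
  rw [weight, Ne, Submodule.finrank_eq_zero, ← Ne, Submodule.ne_bot_iff, mem_linearSet_iff]
  constructor
  · rintro ⟨u, ⟨h1, h2⟩, h0⟩
    exact ⟨u, h1, h0, h2⟩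
  · rintro ⟨u, h1, h0, h2⟩
    exact ⟨u, ⟨h1, h2⟩, h0⟩

/-- The nonzero vectors of `U` are partitioned by the points they define. -/
theorem sum_card_pow_weight [Finite V] [Fintype (ℙ K V)] (U : Submodule F V) :
    ∑ P : ℙ K V, (Nat.card F ^ weight U P - 1) = Nat.card U - 1 := by
  classical
  have := Fintype.ofFinite V
  have hcard : ∀ S : Submodule F V,
      (Finset.univ.filter fun u : V => u ∈ S ∧ u ≠ 0).card = Nat.card S - 1 := by
    intro S
    have : (Finset.univ.filter fun u : V => u ∈ S ∧ u ≠ 0) =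
        (Finset.univ.filter fun u : V => u ∈ S).erase 0 := by
      ext u; simp [and_comm]
    rw [this, Finset.card_erase_of_mem (by simp), Nat.card_eq_fintype_card, Fintype.card_subtype]
  rw [← hcard U]
  have hU : (Finset.univ.filter fun u : V => u ∈ U ∧ u ≠ 0) =
      Finset.univ.biUnion fun P : ℙ K V => Finset.univ.filter fun u : V =>
        u ∈ U ⊓ P.submodule.restrictScalars F ∧ u ≠ 0 := by
    ext u
    simp only [Finset.mem_filter, Finset.mem_univ, true_and, Finset.mem_biUnion,
      Submodule.mem_inf, Submodule.restrictScalars_mem]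
    constructor
    · rintro ⟨h1, h0⟩
      exact ⟨Projectivization.mk K u h0, ⟨h1, (mem_submodule_iff h0).2 rfl⟩, h0⟩
    · rintro ⟨P, ⟨h1, -⟩, h0⟩
      exact ⟨h1, h0⟩
  rw [hU, Finset.card_biUnion]
  · refine Finset.sum_congr rfl fun P _ => ?_
    rw [hcard, natCard_inf_submodule]
  · intro P _ Q _ hPQ
    rw [Function.onFun, Finset.disjoint_left]
    intro u h1 h2
    simp only [Finset.mem_filter, Finset.mem_univ, true_and, Submodule.mem_inf,
      Submodule.restrictScalars_mem] at h1 h2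
    exact hPQ (((mem_submodule_iff h1.2).1 h1.1.2).symm.trans ((mem_submodule_iff h1.2).1 h2.1.2))

/-- A linear set of rank `n` missing `2^(n-2)` points of `PG(1, 2^n)`, all of whose points have
weight `1` or `n - 2`, is an `(n-2)`-club. -/
theorem isClub_of_weights {F K : Type*} [Field F] [Field K] [Algebra F K] [Finite K]
    (hF : Nat.card F = 2) {n : ℕ} (hn : 3 ≤ n) (hK : Nat.card K = 2 ^ n)
    {U : Submodule F (Fin 2 → K)} (hU : Nat.card U = 2 ^ n)
    (hcompl : (linearSet K U)ᶜ.ncard = 2 ^ (n - 2))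
    (hw : ∀ P ∈ linearSet K U, weight U P = 1 ∨ weight U P = n - 2) : IsClub (n - 2) U := by
  classical
  have : Finite (ℙ K (Fin 2 → K)) := (Projectivization.finite_iff_of_finite K _).2 inferInstance
  have := Fintype.ofFinite (ℙ K (Fin 2 → K))
  obtain ⟨m, rfl⟩ : ∃ m, n = m + 3 := ⟨n - 3, by omega⟩
  simp only [show m + 3 - 2 = m + 1 by omega] at *
  have hp : 0 < 2 ^ m := by positivity
  have hL : (linearSet K U).ncard + 2 ^ (m + 1) = 2 ^ (m + 3) + 1 := by
    rw [← hcompl, Set.ncard_add_ncard_compl,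
      Projectivization.card_of_finrank_two K (Fin 2 → K) (by simp), hK]
  set L : Finset (ℙ K (Fin 2 → K)) := Finset.univ.filter (· ∈ linearSet K U) with hLdef
  have hmem : ∀ P, P ∈ L ↔ P ∈ linearSet K U := fun P => by simp [hLdef]
  have hLcard : (linearSet K U).ncard = L.card := by
    rw [← Set.ncard_coe_finset]
    congr 1
    ext P
    simp [hmem]
  -- Subtract |L| = 2^n + 1 - 2^(n-2) from the count 2^n - 1 of nonzero vectors. Points off L
  -- contribute 2^0 - 1 = 0.
  have hsum : ∑ P ∈ L, (2 ^ weight U P - 2) + 2 = 2 ^ (m + 1) := by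
    have h1 := sum_card_pow_weight (K := K) U
    have h2 : ∑ P : ℙ K (Fin 2 → K), (Nat.card F ^ weight U P - 1) =
        ∑ P ∈ L, (2 ^ weight U P - 1) := by
      rw [hF]
      symm
      refine Finset.sum_subset (Finset.subset_univ _) fun P _ hP => ?_
      rw [hmem, ← weight_ne_zero_iff, not_not] at hP
      simp [hP]
    have h3 : ∑ P ∈ L, (2 ^ weight U P - 1) = ∑ P ∈ L, (2 ^ weight U P - 2) + L.card := by
      rw [Finset.card_eq_sum_ones, ← Finset.sum_add_distrib]
      refine Finset.sum_congr rfl fun P hP => ?_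
      have := Nat.pow_le_pow_right (show 0 < 2 by norm_num)
        (Nat.one_le_iff_ne_zero.2 (weight_ne_zero_iff.2 ((hmem P).1 hP)))
      omega
    rw [h2, h3, ← hLcard, hU] at h1
    simp only [pow_succ] at *
    omega
  -- If all weights were one, the sum would vanish and n = 3; then n - 2 = 1 and any point of L
  -- serves.
  obtain ⟨P, hP, hPw⟩ : ∃ P ∈ L, weight U P = m + 1 := by
    by_contra! hcon
    have h0 : ∑ P ∈ L, (2 ^ weight U P - 2) = 0 := Finset.sum_eq_zero fun P hP => by
      rw [(hw P ((hmem P).1 hP)).resolve_right (hcon P hP)]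
      norm_num
    rw [h0] at hsum
    have hm : m = 0 := by
      by_contra hm
      have := Nat.pow_le_pow_right (show 0 < 2 by norm_num) (show 2 ≤ m + 1 by omega)
      omega
    subst hm
    obtain ⟨P, hP⟩ : L.Nonempty := by
      rw [← Finset.card_pos]
      norm_num at hL
      omega
    exact hcon P hP ((hw P ((hmem P).1 hP)).elim (fun h => by simpa using h) id)
  refine ⟨P, (hmem P).1 hP, hPw, fun Q hQ hne => ?_⟩
  rw [← Finset.add_sum_erase L _ hP, hPw] at hsum
  -- The heavy point alone accounts for the whole sum.
  have h0 : ∑ P ∈ L.erase P, (2 ^ weight U P - 2) = 0 := by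
    simp only [pow_succ] at hsum
    omega
  have h1 := (Finset.sum_eq_zero_iff.1 h0) Q (Finset.mem_erase.2 ⟨hne, (hmem Q).2 hQ⟩)
  by_contra h
  have h2 := weight_ne_zero_iff.2 hQ
  have := Nat.pow_le_pow_right (show 0 < 2 by norm_num) (show 2 ≤ weight U Q by omega)
  omega

end Counting

/-! ### From translation arcs to clubs. -/

section TranslationArcs

variable {K : Type*} [Field K] [Algebra (ZMod 2) K]

/-- The right side is below 2^(m+4), so d ≤ m + 3 and hence s ≥ 2^(m+1), the largest permitted
value. -/
theorem two_pow_add_eq {m d s : ℕ} (h : 2 ^ d + s = 2 ^ (m + 3) + 2 ^ (m + 1))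
    (hs : s = 0 ∨ s = 2 ∨ s = 2 ^ (m + 1)) : s = 2 ^ (m + 1) ∧ d = m + 3 := by
  have hp : 0 < 2 ^ m := by positivity
  have hlt : 2 ^ d < 2 ^ (m + 4) := by simp only [pow_succ] at *; omega
  have hd : d < m + 4 := (Nat.pow_lt_pow_iff_right (by norm_num)).1 hlt
  have hle : d ≤ m + 3 := by omega
  have hle' : 2 ^ d ≤ 2 ^ (m + 3) := Nat.pow_le_pow_right (by norm_num) hle
  have hs' : s = 2 ^ (m + 1) := by
    rcases hs with rfl | rfl | rfl
    · simp only [pow_succ] at *; omega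
    · simp only [pow_succ] at *; omega
    · rfl
  refine ⟨hs', Nat.pow_right_injective le_rfl (?_ : 2 ^ d = 2 ^ (m + 3))⟩
  omega

/-- Over the field with two elements additive closure already gives a subspace U; the lines through
the origin determine the rest of A from it. -/
theorem exists_eq_arcOf_of_add_mem {n : ℕ} (hn : 3 ≤ n) (hK : Nat.card K = 2 ^ n)
    {A : Set (ℙ K (Fin 3 → K))} (hA : IsKMArc (2 ^ (n - 2)) A)
    (h0 : affinePoint 0 ∈ A)
    (hadd : ∀ u v, affinePoint u ∈ A → affinePoint v ∈ A → affinePoint (u + v) ∈ A) :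
    ∃ U : Submodule (ZMod 2) (Fin 2 → K), Module.finrank (ZMod 2) U = n ∧ IsClub (n - 2) U ∧
      A = arcOf (U.map (embedLine (ZMod 2) K)) ![0, 0, 1] := by
  have : Finite K := Nat.finite_of_card_ne_zero (by rw [hK]; positivity)
  have : Finite (ℙ K (Fin 3 → K)) := (Projectivization.finite_iff_of_finite K _).2 inferInstance
  have : Finite (ℙ K (Fin 2 → K)) := (Projectivization.finite_iff_of_finite K _).2 inferInstance
  obtain ⟨hcard, hlines⟩ := hA
  let U : Submodule (ZMod 2) (Fin 2 → K) :=
    { carrier := {u | affinePoint u ∈ A}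
      zero_mem' := h0
      add_mem' := fun hu hv => hadd _ _ hu hv
      smul_mem' := fun r u hu => by
        obtain rfl | rfl : r = 0 ∨ r = 1 := by revert r; decide
        · rw [zero_smul]; exact h0
        · rwa [one_smul] }
  have hU : ∀ u, affinePoint u ∈ A ↔ u ∈ U := fun u => Iff.rfl
  have hF : Nat.card (ZMod 2) = 2 := by simp
  have hUcard : Nat.card U = 2 ^ Module.finrank (ZMod 2) U := by
    rw [Module.natCard_eq_pow_finrank (K := ZMod 2), hF]
  obtain ⟨m, rfl⟩ : ∃ m, n = m + 3 := ⟨n - 3, by omega⟩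
  simp only [show m + 3 - 2 = m + 1 by omega] at *
  have hjoin : ∀ P, (A ∩ points (joinOrigin P)).ncard =
      2 ^ weight U P + (A ∩ {linePoint P}).ncard := by
    intro P
    have hset : A ∩ points (joinOrigin P) =
        affinePoint '' ↑(U ⊓ P.submodule.restrictScalars (ZMod 2)) ∪ (A ∩ {linePoint P}) := by
      ext R
      by_cases hR : R ∈ points (lineX2 K)
      · have hR' : R ∉ affinePoint '' ↑(U ⊓ P.submodule.restrictScalars (ZMod 2)) := by
          rintro ⟨u, -, rfl⟩
          exact affinePoint_notMem u hR
        obtain ⟨Q, rfl⟩ : R ∈ Set.range linePoint := by rwa [range_linePoint]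
        simp only [Set.mem_inter_iff, linePoint_mem_joinOrigin, Set.mem_union, hR', false_or,
          Set.mem_singleton_iff, linePoint_injective.eq_iff]
      · have hR' : R ≠ linePoint P := by
          rintro rfl
          exact hR (range_linePoint.subset ⟨P, rfl⟩)
        obtain ⟨u, rfl⟩ := exists_eq_affinePoint hR
        rw [Set.mem_inter_iff, Set.mem_union, affinePoint_injective.mem_set_image,
          affinePoint_mem_joinOrigin, hU]
        simp [hR']
    rw [hset, Set.ncard_union_eq, Set.ncard_image_of_injective _ affinePoint_injective,
      ← Nat.card_coe_set_eq]
    · congr 1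
      have h := natCard_inf_submodule U P
      rwa [hF] at h
    · rw [Set.disjoint_left]
      rintro _ ⟨u, -, rfl⟩ ⟨-, h⟩
      exact affinePoint_notMem u (range_linePoint.subset ⟨P, h.symm⟩)
  have hmem : ∀ P, linePoint P ∈ A → (A ∩ {linePoint P}).ncard = 1 := fun P hP => by
    rw [Set.inter_eq_right.2 (by simpa using hP), Set.ncard_singleton]
  have hnotMem : ∀ P, linePoint P ∉ A → (A ∩ {linePoint P}).ncard = 0 := fun P hP => by
    rw [Set.inter_singleton_eq_empty.2 hP, Set.ncard_empty]
  have hL : ∀ P, linePoint P ∈ A ↔ P ∉ linearSet K U := by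
    intro P
    have h := hlines _ (isLine_joinOrigin P)
    rw [hjoin] at h
    rw [← weight_ne_zero_iff, not_not]
    have hp : 0 < 2 ^ m := by positivity
    -- If P is in A, a positive weight would give an odd intersection size of at least 3. If not,
    -- weight zero would leave the origin alone on the line. Neither size is allowed.
    by_cases hPA : linePoint P ∈ A
    · rw [hmem P hPA] at h
      simp only [hPA, true_iff]
      by_contra hw
      obtain ⟨w, hw⟩ := Nat.exists_eq_succ_of_ne_zero hw
      rw [hw] at h
      simp only [Nat.succ_eq_add_one, pow_succ] at h
      omega
    · rw [hnotMem P hPA] at h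
      simp only [hPA, false_iff]
      intro hw
      rw [hw] at h
      simp only [pow_zero, pow_succ] at h
      omega
  have hw : ∀ P ∈ linearSet K U, weight U P = 1 ∨ weight U P = m + 1 := by
    intro P hP
    have h := hlines _ (isLine_joinOrigin P)
    rw [hjoin, hnotMem P (fun h => (hL P).1 h hP), add_zero] at h
    have hinj := Nat.pow_right_injective (le_refl 2)
    rcases h with h | h | h
    · exact absurd h (by positivity)
    · exact Or.inl (hinj (by simpa using h))
    · exact Or.inr (hinj h)
  have hline : A ∩ points (lineX2 K) = linePoint '' (linearSet K U)ᶜ := by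
    rw [← range_linePoint]
    ext R
    constructor
    · rintro ⟨hR, P, rfl⟩
      exact ⟨P, (hL P).1 hR, rfl⟩
    · rintro ⟨P, hP, rfl⟩
      exact ⟨(hL P).2 hP, P, rfl⟩
  have hoff : A \ points (lineX2 K) = affinePoint '' (U : Set (Fin 2 → K)) := by
    ext R
    constructor
    · rintro ⟨hR, hR'⟩
      obtain ⟨u, rfl⟩ := exists_eq_affinePoint hR'
      exact ⟨u, hR, rfl⟩
    · rintro ⟨u, hu, rfl⟩
      exact ⟨hu, affinePoint_notMem u⟩
  have hline' := hlines _ isLine_lineX2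
  rw [hline, Set.ncard_image_of_injective _ linePoint_injective] at hline'
  have htotal : 2 ^ Module.finrank (ZMod 2) U + (linearSet K U)ᶜ.ncard =
      2 ^ (m + 3) + 2 ^ (m + 1) := by
    rw [← hK, ← hcard, ← Set.ncard_inter_add_ncard_sdiff_eq_ncard A (points (lineX2 K)), hline, hoff,
      Set.ncard_image_of_injective _ linePoint_injective,
      Set.ncard_image_of_injective _ affinePoint_injective, ← hUcard, add_comm]
    rfl
  obtain ⟨hs, hd⟩ := two_pow_add_eq htotal hline'
  refine ⟨U, hd, ?_, eq_arcOf hU hL⟩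
  exact isClub_of_weights (n := m + 3) hF hn hK (by rw [hUcard, hd]) hs hw

/-- A translation KM-arc of type `2^(n-2)` arises from an `(n-2)`-club. -/
theorem IsTranslationKMArc.exists_projEquiv_arcOf {n : ℕ} (hn : 3 ≤ n) (hK : Nat.card K = 2 ^ n)
    {A : Set (ℙ K (Fin 3 → K))} (hA : IsTranslationKMArc (2 ^ (n - 2)) A) :
    ∃ U : Submodule (ZMod 2) (Fin 2 → K), Module.finrank (ZMod 2) U = n ∧ IsClub (n - 2) U ∧
      ProjEquiv A (arcOf (U.map (embedLine (ZMod 2) K)) ![0, 0, 1]) := by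
  have : Finite K := Nat.finite_of_card_ne_zero (by rw [hK]; positivity)
  have : Finite (ℙ K (Fin 3 → K)) := (Projectivization.finite_iff_of_finite K _).2 inferInstance
  obtain ⟨hKM, W, hW, htrans⟩ := hA
  -- Otherwise the axis would contain all 2^n + 2^(n-2) points of A.
  obtain ⟨P, hPA, hPW⟩ : (A \ points W).Nonempty := by
    rw [Set.nonempty_iff_ne_empty]
    intro h
    have h1 : A ∩ points W = A := Set.inter_eq_left.2 (Set.sdiff_eq_empty.1 h)
    have h2 := hKM.2 W hW
    have h3 : 2 ^ 3 ≤ 2 ^ n := Nat.pow_le_pow_right (by norm_num) hn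
    have h4 : 0 < 2 ^ (n - 2) := by positivity
    rw [h1, hKM.1, hK] at h2
    omega
  induction P using Projectivization.ind with
  | h v hv =>
  have hvW : v ∉ W := fun h => hPW ((mk_mem_points hv).2 h)
  obtain ⟨g, ι, hι, hg⟩ := exists_coordinates hW hvW
  have haff : ∀ u, affinePoint u ∈ {P | g • P ∈ A} ↔ v + ι u ∈ cone A := by
    intro u
    rw [Set.mem_ofPred_eq, affinePoint, Projectivization.smul_mk, mk_mem_iff_mem_cone,
      LinearEquiv.smul_def, hg, one_smul, add_comm]
  obtain ⟨U, hU, hclub, hAU⟩ := exists_eq_arcOf_of_add_mem hn hK (hKM.preimage_smul g)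
    (by rw [haff, map_zero, add_zero]; exact ⟨hv, hPA⟩)
    (fun u w hu hw => by
      rw [haff] at *
      rw [map_add]
      exact add_mem_cone_of_transitive hW htrans hvW (hι u) (hι w) ⟨hv, hPA⟩ hu hw)
  refine ⟨U, hU, hclub, g⁻¹, ?_⟩
  rw [← hAU]
  ext P
  constructor
  · rintro ⟨Q, hQ, rfl⟩
    simpa using hQ
  · intro hP
    exact ⟨g • P, hP, by simp⟩

end TranslationArcs

end KMArcs

/-! ### The classification. -/

theorem mainTheorem10 {K : Type*} [Field K] [Algebra (ZMod 2) K] (n : ℕ) (hn : 3 ≤ n)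
    (hK : Nat.card K = 2 ^ n) (A : Set (ℙ K (Fin 3 → K)))
    (hA : KMArcs.IsTranslationKMArc (2 ^ (n - 2)) A) :
    ∃ (t l : ℕ) (a b c : K) (S : Submodule (IntermediateField.adjoin (ZMod 2) {b}) K),
      KMArcs.IsClubData n t l a b c S ∧
      Module.finrank (ZMod 2) (KMArcs.clubSpace t a b c S) = n ∧
      KMArcs.IsClub (n - 2) (KMArcs.clubSpace t a b c S) ∧
      KMArcs.ProjEquiv A
        (KMArcs.arcOf ((KMArcs.clubSpace t a b c S).map (KMArcs.embedLine (ZMod 2) K))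
          ![0, 0, 1]) := by
  have : Finite K := Nat.finite_of_card_ne_zero (by rw [hK]; positivity)
  have hrank : Module.finrank (ZMod 2) K = n := by
    have h := Module.natCard_eq_pow_finrank (K := ZMod 2) (V := K)
    rw [hK, Nat.card_zmod] at h
    exact (Nat.pow_right_injective le_rfl h).symm
  obtain ⟨U, hU, hclub, hAU⟩ := hA.exists_projEquiv_arcOf hn hK
  obtain ⟨h, t, l, a, b, c, S, hdata, hS⟩ := hclub.exists_map_eq_clubSpace hn hrank hU
  refine ⟨t, l, a, b, c, S, hdata, ?_, ?_, ?_⟩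
  · rw [← hS, LinearEquiv.finrank_map_eq, hU]
  · rw [← hS]
    exact hclub.map h
  · rw [← hS]
    exact hAU.trans (KMArcs.projEquiv_arcOf_map h U)
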